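/- **Setting.** Let $n,m\in\mathbb N$ and $N>0$, and write $\mathrm D_t=-\mathrm i\,\partial_t$ (one-sided at $t=0$). The hyperbolic zone (with $\nu=0$) is $$Z_{hyp}=\{(t,\xi)\in[0,\infty)\times\mathbb R^n : (1+t)|\xi|\ge N\}.$$ Put $|\xi|_t=\max(|\xi|,\,N/(1+t))$. A function $a:[0,\infty)\times(\mathbb R^n\setminus\{0\})\to\mathbb C$ belongs to $\mathcal S\{m_1,m_2\}$ $(=\mathcal S^{0,\infty}_{N,0}\{m_1,m_2\})$ if it is smooth in $t$ and for every $k\ge 0$ there is $C_k$ with $$|\mathrm D_t^k a(t,\xi)|\le C_k\,|\xi|_t^{m_1}\Big(\frac1{1+t}\Big)^{m_2+k}\qquad\text{for all } t\ge0,\ \xi\ne0;$$ a matrix-valued function belongs to $\mathcal S\{m_1,m_2\}$ if all its entries do. Let $\chi\in C_0^\infty(\mathbb R)$ be a real-valued function with $\chi(s)=1$ for $0\le s\le\frac12$ and $\chi(s)=0$ for $s>1$, and put $\chi_{hyp}(t,\xi)=1-\chi(|\xi|(1+t)/N)$. Let $A(t,\xi)\in\mathbb C^{m\times m}$, $t\ge0$,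 $\xi\neq0$, satisfy the following two assumptions. * **(A1)$_{0,\infty}$ with $\nu=0$:** $A(t,\cdot)$ is continuous on $\mathbb R^n\setminus\{0\}$ for each $t\ge0$, $A\in\mathcal S\{1,0\}$, and there is $c$ such that all eigenvalues $\zeta$ of $A(t,\xi)$ satisfy $|\operatorname{Im}\zeta|\le c$ for all $(t,\xi)\in Z_{hyp}$. * **(A2):** there is a matrix function $A_1(t,\xi)$, positively homogeneous of order one in $\xi\ne0$, with $A-\chi_{hyp}A_1\in\mathcal S\{0,1\}$, whose eigenvalues are real and distinct, $\lambda_1(t,\xi)<\dots<\lambda_m(t,\xi)$ for all $t\ge0$, $\xi\ne0$, with $\lambda_j\in\mathcal S\{1,0\}$ for all $j$ and, for all $i\neq j$, $$\liminf_{t\to\infty}\ \min_{|\omega|=1}|\lambda_i(t,\omega)-\lambda_j(t,\omega)|>0 .$$ A *diagonaliser* of $A_1$ is a matrix function $M(t,\xi)$, $t\ge0$, $\xi\neq0$, that is invertible everywhere and satisfies $M,M^{-1}\in\mathcal S\{0,0\}$ and $A_1M=M\operatorname{diag}(\lambda_1,\dots,\lambda_m)$. Given $M$, let $$F_0=\operatorname{diag}\big(M^{-1}(A-A_1)M-M^{-1}(\mathrm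 D_tM)\big)$$ (the diagonal part of the matrix in brackets), and let $\operatorname{Im}B=\frac1{2\mathrm i}(B-B^*)$ for a matrix $B$. The generalised energy conservation property is * **(A3):** $\displaystyle \sup_{(s,\xi),(t,\xi)\in Z_{hyp}}\Big\|\int_s^t\operatorname{Im}F_0(\theta,\xi)\,\mathrm d\theta\Big\|<\infty .$ Let $\mathcal E(t,s,\xi)$, $s,t\ge 0$, $\xi\neq0$, be the fundamental solution: $\mathrm D_t\mathcal E(t,s,\xi)=A(t,\xi)\mathcal E(t,s,\xi)$, $\mathcal E(s,s,\xi)=\mathrm I$. **Theorem.** Assume (A1)$_{0,\infty}$ with $\nu=0$ and (A2). Then a diagonaliser of $A_1$ exists, and for every diagonaliser $M$ of $A_1$, (A3) is equivalent to the existence of a constant $C>0$ such that $$C^{-1}\|V\|\le\|\mathcal E(t,s,\xi)V\|\le C\|V\|$$ for all $V\in\mathbb C^m$ and all $(t,\xi),(s,\xi)\in Z_{hyp}$. -/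

import Mathlib

open scoped Matrix Matrix.Norms.L2Operator ContDiff

noncomputable section

namespace HyperbolicSystem

/-- The hyperbolic zone `Z_hyp(N, 0) = {(t, ξ) | t ≥ 0, t ≥ t_ξ}`, where `t_ξ` is given by
`(1 + t_ξ) |ξ| = N`; so `t ≥ t_ξ` means `(1 + t) |ξ| ≥ N`. -/
def hypZone (n : ℕ) (N : ℝ) : Set (ℝ × EuclideanSpace ℝ (Fin n)) :=
  {p | 0 ≤ p.1 ∧ N ≤ (1 + p.1) * ‖p.2‖}

/-- The weight `|ξ|_t = max (|ξ|, N / (1 + t))`. -/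
def weight {n : ℕ} (N t : ℝ) (ξ : EuclideanSpace ℝ (Fin n)) : ℝ :=
  max ‖ξ‖ (N / (1 + t))

/-- The symbol class `S_{N,0}^{0,∞}{m₁, m₂}` (no `ξ`-derivatives, all `t`-derivatives, `ν = 0`)
on `t ≥ 0`, `ξ ≠ 0`: every `a(·, ξ)` is smooth on `[0, ∞)` (one-sided at `0`) and
`|∂_t^k a(t, ξ)| ≤ C_k |ξ|_t ^ m₁ (1 / (1 + t)) ^ (m₂ + k)` for all `k`. -/
structure IsSymbol {n : ℕ} (N : ℝ) (m₁ m₂ : ℤ)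
    (a : ℝ → EuclideanSpace ℝ (Fin n) → ℂ) : Prop where
  smooth : ∀ ξ, ξ ≠ 0 → ContDiffOn ℝ ∞ (fun τ => a τ ξ) (Set.Ici 0)
  estimate : ∀ k : ℕ, ∃ C : ℝ, ∀ t, 0 ≤ t → ∀ ξ, ξ ≠ 0 →
    ‖iteratedDerivWithin k (fun τ => a τ ξ) (Set.Ici 0) t‖
      ≤ C * weight N t ξ ^ m₁ * (1 / (1 + t)) ^ (m₂ + (k : ℤ))

/-- Matrix-valued symbols: every entry is a symbol. -/
def IsMatrixSymbol {n m : ℕ} (N : ℝ) (m₁ m₂ : ℤ)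
    (A : ℝ → EuclideanSpace ℝ (Fin n) → Matrix (Fin m) (Fin m) ℂ) : Prop :=
  ∀ i j, IsSymbol N m₁ m₂ (fun t ξ => A t ξ i j)

/-- Smooth cut-off profiles on `[0, ∞)`: equal to `1` up to `1/2` and to `0` beyond `1`. -/
structure IsCutoff (χ : ℝ → ℝ) : Prop where
  smooth : ContDiff ℝ ∞ χ
  compactSupport : HasCompactSupport χ
  eq_one : ∀ s, 0 ≤ s → s ≤ 1 / 2 → χ s = 1
  eq_zero : ∀ s, 1 < s → χ s = 0

/-- `χ_hyp(t, ξ) = 1 - χ (|ξ| (1 + t) / N)`. -/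
def cutoffHyp {n : ℕ} (χ : ℝ → ℝ) (N t : ℝ) (ξ : EuclideanSpace ℝ (Fin n)) : ℝ :=
  1 - χ (‖ξ‖ * (1 + t) / N)

/-- Assumption (A1) with `ℓ₁ = 0`, `ℓ₂ = ∞`, `ν = 0`: the symbol `A` is continuous in `ξ ≠ 0`,
lies in `S_{N,0}^{0,∞}{1, 0}`, and its spectrum lies in a fixed strip on the hyperbolic zone. -/
structure AssumptionA1 {n m : ℕ} (N : ℝ)
    (A : ℝ → EuclideanSpace ℝ (Fin n) → Matrix (Fin m) (Fin m) ℂ) : Prop where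
  continuous : ∀ t, 0 ≤ t → ∀ i j, ContinuousOn (fun ξ => A t ξ i j) {ξ | ξ ≠ 0}
  symbol : IsMatrixSymbol N 1 0 A
  strip : ∃ c : ℝ, ∀ t ξ, (t, ξ) ∈ hypZone n N →
    ∀ ζ ∈ spectrum ℂ (A t ξ), |ζ.im| ≤ c

/-- Assumption (A2) for `A`, with homogeneous principal part `A₁` and characteristic roots
`lam 0 < lam 1 < … < lam (m - 1)`. The field `gap` says that
`liminf_{t → ∞} min_{|η| = 1} |λ_i(t, η) - λ_j(t, η)| > 0` for all `i ≠ j`. -/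
structure AssumptionA2 {n m : ℕ} (N : ℝ) (χ : ℝ → ℝ)
    (A A₁ : ℝ → EuclideanSpace ℝ (Fin n) → Matrix (Fin m) (Fin m) ℂ)
    (lam : Fin m → ℝ → EuclideanSpace ℝ (Fin n) → ℝ) : Prop where
  homogeneous : ∀ t, 0 ≤ t → ∀ ξ, ξ ≠ 0 → ∀ r : ℝ, 0 < r →
    A₁ t (r • ξ) = (r : ℂ) • A₁ t ξ
  lowerOrder : IsMatrixSymbol N 0 1 (fun t ξ => A t ξ - (cutoffHyp χ N t ξ : ℂ) • A₁ t ξ)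
  spectrum_eq : ∀ t, 0 ≤ t → ∀ ξ, ξ ≠ 0 →
    spectrum ℂ (A₁ t ξ) = Set.range (fun j => (lam j t ξ : ℂ))
  strictMono : ∀ t, 0 ≤ t → ∀ ξ, ξ ≠ 0 → StrictMono (fun j => lam j t ξ)
  symbol_roots : ∀ j, IsSymbol N 1 0 (fun t ξ => (lam j t ξ : ℂ))
  gap : ∀ i j, i ≠ j → ∃ c : ℝ, 0 < c ∧ ∀ᶠ t in Filter.atTop,
    ∀ η : EuclideanSpace ℝ (Fin n), ‖η‖ = 1 → c ≤ |lam i t η - lam j t η|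

/-- `M` is an admissible diagonaliser of `A₁`: it is invertible, `M` and `M⁻¹` belong to
`S_{N,0}^{0,∞}{0, 0}` and `A₁ M = M diag(λ_1, …, λ_m)`. No continuity of `M` in `ξ` is required:
the eigenspaces need not have a globally continuous basis. -/
structure IsDiagonaliser {n m : ℕ} (N : ℝ)
    (A₁ : ℝ → EuclideanSpace ℝ (Fin n) → Matrix (Fin m) (Fin m) ℂ)
    (lam : Fin m → ℝ → EuclideanSpace ℝ (Fin n) → ℝ)
    (M : ℝ → EuclideanSpace ℝ (Fin n) → Matrix (Fin m) (Fin m) ℂ) : Prop where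
  invertible : ∀ t, 0 ≤ t → ∀ ξ, ξ ≠ 0 → IsUnit (M t ξ).det
  symbol : IsMatrixSymbol N 0 0 M
  symbol_inv : IsMatrixSymbol N 0 0 (fun t ξ => (M t ξ)⁻¹)
  diagonalises : ∀ t, 0 ≤ t → ∀ ξ, ξ ≠ 0 →
    A₁ t ξ * M t ξ = M t ξ * Matrix.diagonal (fun j => (lam j t ξ : ℂ))

/-- The entrywise `D_t M = -i ∂_t M` on `[0, ∞)` (one-sided derivative at `t = 0`). -/
def Dt {n m : ℕ} (M : ℝ → EuclideanSpace ℝ (Fin n) → Matrix (Fin m) (Fin m) ℂ)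
    (t : ℝ) (ξ : EuclideanSpace ℝ (Fin n)) : Matrix (Fin m) (Fin m) ℂ :=
  Matrix.of fun i j => -Complex.I * derivWithin (fun τ => M τ ξ i j) (Set.Ici 0) t

/-- `F₀ = diag (M⁻¹ (A - A₁) M - M⁻¹ (D_t M))`, where `diag` keeps the diagonal of a matrix. -/
def F0 {n m : ℕ} (A A₁ M : ℝ → EuclideanSpace ℝ (Fin n) → Matrix (Fin m) (Fin m) ℂ)
    (t : ℝ) (ξ : EuclideanSpace ℝ (Fin n)) : Matrix (Fin m) (Fin m) ℂ :=
  Matrix.diagonal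
    (((M t ξ)⁻¹ * (A t ξ - A₁ t ξ) * M t ξ - (M t ξ)⁻¹ * Dt M t ξ).diag)

/-- The imaginary part `Im B = (B - B*) / (2i)` of a matrix. -/
def imPart {m : ℕ} (B : Matrix (Fin m) (Fin m) ℂ) : Matrix (Fin m) (Fin m) ℂ :=
  (1 / (2 * Complex.I)) • (B - Bᴴ)

/-- Assumption (A3), generalised energy conservation: the entrywise integrals
`∫_s^t Im F₀(θ, ξ) dθ` are bounded in operator norm, uniformly over the hyperbolic zone. -/
def AssumptionA3 {n m : ℕ} (N : ℝ)
    (A A₁ M : ℝ → EuclideanSpace ℝ (Fin n) → Matrix (Fin m) (Fin m) ℂ) : Prop :=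
  ∃ C : ℝ, ∀ s t ξ, (s, ξ) ∈ hypZone n N → (t, ξ) ∈ hypZone n N →
    ‖(Matrix.of fun i j => ∫ θ in s..t, imPart (F0 A A₁ M θ ξ) i j :
      Matrix (Fin m) (Fin m) ℂ)‖ ≤ C

/-- `E(t, s, ξ)` is the fundamental solution: `D_t E = A E`, i.e. `∂_t E = i A E`, on `t ≥ 0`,
and `E(s, s, ξ) = I`. -/
structure IsFundamentalSolution {n m : ℕ}
    (A : ℝ → EuclideanSpace ℝ (Fin n) → Matrix (Fin m) (Fin m) ℂ)
    (E : ℝ → ℝ → EuclideanSpace ℝ (Fin n) → Matrix (Fin m) (Fin m) ℂ) : Prop where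
  initial : ∀ s, 0 ≤ s → ∀ ξ, ξ ≠ 0 → E s s ξ = 1
  ode : ∀ s, 0 ≤ s → ∀ ξ, ξ ≠ 0 → ∀ t, 0 ≤ t → ∀ i j,
    HasDerivWithinAt (fun τ => E τ s ξ i j) (Complex.I * (A t ξ * E t s ξ) i j) (Set.Ici 0) t

end HyperbolicSystem

end

/-! In the zone, `W = M⁻¹ U` satisfies `D_t W = (Λ + R) W` with `Λ` real diagonal, `R = O(1/(1+t))`
and `F₀ = diag R`. Real `Λ` does not affect the modulus of a component, but the off-diagonal part of
`R` is not integrable in time. One further step removes it. With `Q_jk = R_jk / (λ_j - λ_k)` taken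
at the direction of `ξ`, the vector `z = (1 + |ξ|⁻¹ Q) W` satisfies `D_t z = (Λ + diag R) z + |ξ|⁻¹
B W` with `B = O((1+t)⁻²)`. On `(1+t)|ξ| ≥ N'` the factor `|ξ|⁻¹ (1+t)⁻²` has integral at most
`1/N'`, uniformly in `ξ`, and for large `N'` the change from `W` to `z` is invertible. The strip
between the thresholds `N` and `N'` costs only a power of `N'/N`. So up to uniform factors `|z_j|²`
evolves like `exp(-2 ∫ Im R_jj)`.

If these integrals are bounded, Gronwall's inequality for `∑ |z_j|² exp(2 ∫ Im R_jj)` bounds the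
energy in both time directions (`ReducedSystem.normSqSum_z_le`). Conversely, let all solutions be
bounded and let `g` be a primitive of `Im R_jj`. On a compact interval start the solution with `W =
e_j` where `g` is maximal. There the weight `exp(2g)` is largest, so the remainder cannot use up
more than half of `|z_j|² exp(2g)`, and boundedness of `z_j` limits how far `g` can drop
(`sub_le_of_bounded_solutions`).

A diagonaliser is built frequency by frequency, with no continuity in `ξ`. The roots are uniformly
separated on the sphere: for large times by the liminf condition, for bounded times by compactness
and the discriminant, which needs only `A₁` to be continuous (`AssumptionA2.exists_gap`). Hence the
spectral projections are symbols. Parallel transport in their ranges, followed by normalisation,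
gives the columns of `M` (`exists_unit_section`). -/

namespace HyperbolicSystem

open Set

/-! ### Symbols in time, uniform over an index set -/

section TSymbol

variable {ι : Type*}

/-- `a i t = O((1 + t)^(-d))` on `t ≥ 0`, uniformly in `i`. -/
def Decays (d : ℕ) (a : ι → ℝ → ℂ) : Prop :=
  ∃ C : ℝ, ∀ i t, 0 ≤ t → ‖a i t‖ * (1 + t) ^ d ≤ C

/-- The first `k` derivatives of `a i` exist on `[0, ∞)` and decay like
`(1 + t)^(-d)`, …, `(1 + t)^(-d-k)`, uniformly in `i`. -/
def TSymbolUpTo : ℕ → ℕ → (ι → ℝ → ℂ) → Prop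
  | 0, d, a => Decays d a
  | k + 1, d, a => Decays d a ∧ (∀ i t, 0 ≤ t → DifferentiableWithinAt ℝ (a i) (Ici 0) t) ∧
      TSymbolUpTo k (d + 1) (fun i => derivWithin (a i) (Ici 0))

/-- Symbols of order `-d` in `1 + t`, uniform over the index set. -/
def TSymbol (d : ℕ) (a : ι → ℝ → ℂ) : Prop := ∀ k, TSymbolUpTo k d a

theorem uniqueDiff_Ici {t : ℝ} (ht : 0 ≤ t) : UniqueDiffWithinAt ℝ (Ici (0 : ℝ)) t :=
  uniqueDiffOn_Ici 0 t ht

theorem Decays.congr {d : ℕ} {a b : ι → ℝ → ℂ} (h : Decays d a)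
    (hab : ∀ i t, 0 ≤ t → a i t = b i t) : Decays d b := by
  obtain ⟨C, hC⟩ := h
  exact ⟨C, fun i t ht => by rw [← hab i t ht]; exact hC i t ht⟩

theorem TSymbolUpTo.decays {k d : ℕ} {a : ι → ℝ → ℂ} (h : TSymbolUpTo k d a) : Decays d a := by
  cases k with
  | zero => exact h
  | succ k => exact h.1

theorem TSymbolUpTo.congr {k d : ℕ} {a b : ι → ℝ → ℂ} (h : TSymbolUpTo k d a)
    (hab : ∀ i t, 0 ≤ t → a i t = b i t) : TSymbolUpTo k d b := by
  induction k generalizing d a b with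
  | zero => exact Decays.congr h hab
  | succ k ih =>
    obtain ⟨h1, h2, h3⟩ := h
    refine ⟨h1.congr hab, fun i t ht => ?_, ih h3 fun i t ht => ?_⟩
    · exact (h2 i t ht).congr (fun s hs => (hab i s hs).symm) (hab i t ht).symm
    · exact derivWithin_congr (fun s hs => hab i s hs) (hab i t ht)

theorem TSymbolUpTo.of_hasDeriv {k d : ℕ} {a a' : ι → ℝ → ℂ} (h : Decays d a)
    (hd : ∀ i t, 0 ≤ t → HasDerivWithinAt (a i) (a' i t) (Ici 0) t)
    (h' : TSymbolUpTo k (d + 1) a') : TSymbolUpTo (k + 1) d a :=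
  ⟨h, fun i t ht => (hd i t ht).differentiableWithinAt,
    h'.congr fun i t ht => ((hd i t ht).derivWithin (uniqueDiff_Ici ht)).symm⟩

theorem TSymbolUpTo.hasDeriv {k d : ℕ} {a : ι → ℝ → ℂ} (h : TSymbolUpTo (k + 1) d a)
    (i : ι) {t : ℝ} (ht : 0 ≤ t) :
    HasDerivWithinAt (a i) (derivWithin (a i) (Ici 0) t) (Ici 0) t :=
  (h.2.1 i t ht).hasDerivWithinAt

theorem TSymbolUpTo.of_succ {k d : ℕ} {a : ι → ℝ → ℂ} (h : TSymbolUpTo (k + 1) d a) :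
    TSymbolUpTo k d a := by
  induction k generalizing d a with
  | zero => exact h.1
  | succ k ih => exact ⟨h.1, h.2.1, ih h.2.2⟩

theorem Decays.add {d : ℕ} {a b : ι → ℝ → ℂ} (ha : Decays d a) (hb : Decays d b) :
    Decays d (fun i t => a i t + b i t) := by
  obtain ⟨C, hC⟩ := ha
  obtain ⟨D, hD⟩ := hb
  refine ⟨C + D, fun i t ht => ?_⟩
  have h1 := hC i t ht
  have h2 := hD i t ht
  have h3 : ‖a i t + b i t‖ * (1 + t) ^ d ≤ (‖a i t‖ + ‖b i t‖) * (1 + t) ^ d := by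
    gcongr
    exact norm_add_le _ _
  linarith

theorem Decays.mul {d e : ℕ} {a b : ι → ℝ → ℂ} (ha : Decays d a) (hb : Decays e b) :
    Decays (d + e) (fun i t => a i t * b i t) := by
  obtain ⟨C, hC⟩ := ha
  obtain ⟨D, hD⟩ := hb
  refine ⟨C * D, fun i t ht => ?_⟩
  calc ‖a i t * b i t‖ * (1 + t) ^ (d + e)
      = (‖a i t‖ * (1 + t) ^ d) * (‖b i t‖ * (1 + t) ^ e) := by rw [norm_mul, pow_add]; ring
    _ ≤ C * D := mul_le_mul (hC i t ht) (hD i t ht) (by positivity)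
        (le_trans (by positivity) (hC i t ht))

theorem TSymbolUpTo.add {k d : ℕ} {a b : ι → ℝ → ℂ} (ha : TSymbolUpTo k d a)
    (hb : TSymbolUpTo k d b) : TSymbolUpTo k d (fun i t => a i t + b i t) := by
  induction k generalizing d a b with
  | zero => exact Decays.add ha hb
  | succ k ih =>
    exact .of_hasDeriv (ha.decays.add hb.decays)
      (fun i t ht => (ha.hasDeriv i ht).add (hb.hasDeriv i ht)) (ih ha.2.2 hb.2.2)

/-- Leibniz rule. Keeping the number `k` of derivatives finite lets later arguments bootstrap: a
function whose derivative is expressed through itself gains one level at a time. -/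
theorem TSymbolUpTo.mul {k d e : ℕ} {a b : ι → ℝ → ℂ} (ha : TSymbolUpTo k d a)
    (hb : TSymbolUpTo k e b) : TSymbolUpTo k (d + e) (fun i t => a i t * b i t) := by
  induction k generalizing d e a b with
  | zero => exact Decays.mul ha hb
  | succ k ih =>
    refine .of_hasDeriv (ha.decays.mul hb.decays)
      (fun i t ht => (ha.hasDeriv i ht).mul (hb.hasDeriv i ht)) (.add ?_ ?_)
    · have := ih ha.2.2 hb.of_succ
      rwa [show d + 1 + e = d + e + 1 by ring] at this
    · exact ih (d := d) (e := e + 1) ha.of_succ hb.2.2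

theorem TSymbolUpTo.conj {k d : ℕ} {a : ι → ℝ → ℂ} (ha : TSymbolUpTo k d a) :
    TSymbolUpTo k d (fun i t => star (a i t)) := by
  induction k generalizing d a with
  | zero =>
    obtain ⟨C, hC⟩ := ha
    exact ⟨C, fun i t ht => by simpa using hC i t ht⟩
  | succ k ih =>
    refine .of_hasDeriv ?_ (fun i t ht => (ha.hasDeriv i ht).star) (ih ha.2.2)
    obtain ⟨C, hC⟩ := ha.decays
    exact ⟨C, fun i t ht => by simpa using hC i t ht⟩

theorem Decays.zero (d : ℕ) : Decays d (fun (_ : ι) _ => 0) := ⟨0, by simp⟩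

theorem TSymbolUpTo.zero (k d : ℕ) : TSymbolUpTo k d (fun (_ : ι) _ => 0) := by
  induction k generalizing d with
  | zero => exact Decays.zero d
  | succ k ih => exact .of_hasDeriv (Decays.zero d) (fun _ t _ => hasDerivWithinAt_const t _ _) (ih _)

namespace TSymbol

variable {d e : ℕ} {a b : ι → ℝ → ℂ}

theorem decays (h : TSymbol d a) : Decays d a := h 0

theorem congr (h : TSymbol d a) (hab : ∀ i t, 0 ≤ t → a i t = b i t) : TSymbol d b :=
  fun k => (h k).congr hab

theorem add (ha : TSymbol d a) (hb : TSymbol d b) : TSymbol d (fun i t => a i t + b i t) :=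
  fun k => (ha k).add (hb k)

theorem mul (ha : TSymbol d a) (hb : TSymbol e b) : TSymbol (d + e) (fun i t => a i t * b i t) :=
  fun k => (ha k).mul (hb k)

theorem conj (ha : TSymbol d a) : TSymbol d (fun i t => star (a i t)) := fun k => (ha k).conj

theorem zero (d : ℕ) : TSymbol d (fun (_ : ι) _ => 0) := fun k => TSymbolUpTo.zero k d

theorem hasDeriv (h : TSymbol d a) (i : ι) {t : ℝ} (ht : 0 ≤ t) :
    HasDerivWithinAt (a i) (derivWithin (a i) (Ici 0) t) (Ici 0) t :=
  (h 1).hasDeriv i ht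

theorem deriv (h : TSymbol d a) : TSymbol (d + 1) (fun i => derivWithin (a i) (Ici 0)) :=
  fun k => (h (k + 1)).2.2

theorem of_le (h : TSymbol e a) (hde : d ≤ e) : TSymbol d a := by
  intro k
  induction k generalizing d e a with
  | zero =>
    obtain ⟨C, hC⟩ := h.decays
    refine ⟨C, fun i t ht => le_trans ?_ (hC i t ht)⟩
    gcongr
    linarith
  | succ k ih =>
    refine ⟨(h 0 |> fun hC => ?_), (h 1).2.1, ih h.deriv (by omega)⟩
    obtain ⟨C, hC⟩ := hC
    refine ⟨C, fun i t ht => le_trans ?_ (hC i t ht)⟩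
    gcongr
    linarith

/-- Functions that do not depend on `t` and are bounded. -/
theorem const (c : ι → ℂ) (hc : ∃ C : ℝ, ∀ i, ‖c i‖ ≤ C) : TSymbol 0 (fun i _ => c i) := by
  have h : Decays 0 (fun i (_ : ℝ) => c i) := by
    obtain ⟨C, hC⟩ := hc
    exact ⟨C, fun i t _ => by simpa using hC i⟩
  intro k
  cases k with
  | zero => exact h
  | succ k =>
    exact .of_hasDeriv h (fun _ t _ => hasDerivWithinAt_const t _ _) (TSymbolUpTo.zero k _)

theorem const_mul (ha : TSymbol d a) (c : ℂ) : TSymbol d (fun i t => c * a i t) := by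
  simpa using (const (fun _ : ι => c) ⟨‖c‖, fun _ => le_rfl⟩).mul ha

theorem neg (ha : TSymbol d a) : TSymbol d (fun i t => -a i t) := by
  simpa using ha.const_mul (-1)

theorem sub (ha : TSymbol d a) (hb : TSymbol d b) : TSymbol d (fun i t => a i t - b i t) := by
  simpa [sub_eq_add_neg] using ha.add hb.neg

theorem sum {α : Type*} (s : Finset α) {f : α → ι → ℝ → ℂ} (h : ∀ x ∈ s, TSymbol d (f x)) :
    TSymbol d (fun i t => ∑ x ∈ s, f x i t) := by
  classical
  induction s using Finset.induction_on with
  | empty => simpa using zero d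
  | insert x s hx ih =>
    simp only [Finset.sum_insert hx]
    exact (h x (by simp)).add (ih fun y hy => h y (by simp [hy]))

/-- Symbols of order `0` that are bounded away from `0` are invertible. -/
theorem inv (ha : TSymbol 0 a) {c : ℝ} (hc : 0 < c) (hac : ∀ i t, 0 ≤ t → c ≤ ‖a i t‖) :
    TSymbol 0 (fun i t => (a i t)⁻¹) := by
  have hD : Decays 0 (fun i t => (a i t)⁻¹) :=
    ⟨c⁻¹, fun i t ht => by simpa using inv_anti₀ hc (hac i t ht)⟩
  intro k
  induction k with
  | zero => exact hD
  | succ k ih =>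
    -- The derivative `-a' a⁻¹ a⁻¹` involves only level `k` of `a⁻¹`, which is the induction
    -- hypothesis.
    refine .of_hasDeriv hD (fun i t ht => ?_)
      (by simpa using ((ha.neg.deriv k).mul ih).mul ih)
    have hne : a i t ≠ 0 := fun h0 => by
      have := hac i t ht
      rw [h0, norm_zero] at this
      linarith
    refine ((ha.hasDeriv i ht).fun_inv hne).congr_deriv ?_
    have hn : derivWithin (fun s => -a i s) (Ici 0) t = _ :=
      (ha.hasDeriv i ht).fun_neg.derivWithin (uniqueDiff_Ici ht)
    rw [hn]
    simp only [div_eq_mul_inv]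
    ring

theorem of_iteratedDerivWithin (hs : ∀ i, ContDiffOn ℝ ∞ (a i) (Ici 0))
    (hb : ∀ k : ℕ, ∃ C : ℝ, ∀ i t, 0 ≤ t →
      ‖iteratedDerivWithin k (a i) (Ici 0) t‖ * (1 + t) ^ (d + k) ≤ C) : TSymbol d a := by
  intro k
  induction k generalizing d a with
  | zero => simpa [TSymbolUpTo, Decays] using hb 0
  | succ k ih =>
    refine ⟨by simpa [Decays] using hb 0, fun i t ht => (hs i).differentiableOn (by simp) t ht, ih ?_ ?_⟩
    · exact fun i => ((contDiffOn_infty_iff_derivWithin (uniqueDiffOn_Ici 0)).1 (hs i)).2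
    · intro l
      obtain ⟨C, hC⟩ := hb (l + 1)
      refine ⟨C, fun i t ht => ?_⟩
      have := hC i t ht
      rw [iteratedDerivWithin_succ'] at this
      rwa [show d + 1 + l = d + (l + 1) by ring]

theorem contDiffOn (h : TSymbol d a) (i : ι) : ContDiffOn ℝ ∞ (a i) (Ici 0) := by
  rw [contDiffOn_infty]
  intro k
  induction k generalizing d a with
  | zero =>
    refine contDiffOn_zero.2 fun t ht => ?_
    exact (h.hasDeriv i ht).continuousWithinAt
  | succ k ih =>
    rw [Nat.cast_succ, contDiffOn_succ_iff_derivWithin (uniqueDiffOn_Ici 0)]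
    refine ⟨fun t ht => (h.hasDeriv i ht).differentiableWithinAt, by simp, ih h.deriv⟩

theorem iteratedDerivWithin_bound (h : TSymbol d a) (k : ℕ) : ∃ C : ℝ, ∀ i t, 0 ≤ t →
    ‖iteratedDerivWithin k (a i) (Ici 0) t‖ * (1 + t) ^ (d + k) ≤ C := by
  induction k generalizing d a with
  | zero => simpa [Decays] using h.decays
  | succ k ih =>
    obtain ⟨C, hC⟩ := ih h.deriv
    refine ⟨C, fun i t ht => ?_⟩
    rw [iteratedDerivWithin_succ', show d + (k + 1) = d + 1 + k by ring]
    exact hC i t ht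

end TSymbol

end TSymbol

/-! ### Relation with the symbol classes `S_{N,0}^{0,∞}{m₁, m₂}` -/

section IsSymbol

variable {n m : ℕ} {N : ℝ}

theorem weight_pos (hN : 0 < N) {t : ℝ} (ht : 0 ≤ t) (ξ : EuclideanSpace ℝ (Fin n)) :
    0 < weight N t ξ := lt_max_of_lt_right (by positivity)

theorem one_div_zpow_mul_pow {t : ℝ} (ht : 0 ≤ t) (d k : ℕ) :
    (1 / (1 + t)) ^ ((d : ℤ) + (k : ℤ)) * (1 + t) ^ (d + k) = 1 := by
  rw [← Nat.cast_add, zpow_natCast, ← mul_pow, one_div, inv_mul_cancel₀ (by positivity), one_pow]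

/-- A symbol restricted to frequencies with bounded weight is a time symbol. -/
theorem IsSymbol.tsymbol_of_weight_le {ι : Type*} (hN : 0 < N) {m₁ d : ℕ}
    {a : ℝ → EuclideanSpace ℝ (Fin n) → ℂ} (ha : IsSymbol N m₁ d a)
    (f : ι → EuclideanSpace ℝ (Fin n)) (hf : ∀ i, f i ≠ 0) {r : ℝ}
    (hr : ∀ i t, 0 ≤ t → weight N t (f i) ^ m₁ ≤ r) :
    TSymbol d (fun i t => a t (f i)) := by
  refine TSymbol.of_iteratedDerivWithin (fun i => ha.smooth _ (hf i)) fun k => ?_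
  obtain ⟨C, hC⟩ := ha.estimate k
  refine ⟨|C| * r, fun i t ht => ?_⟩
  have hw : 0 < weight N t (f i) := weight_pos hN ht _
  calc _ ≤ (C * weight N t (f i) ^ (m₁ : ℤ) * (1 / (1 + t)) ^ ((d : ℤ) + (k : ℤ)))
            * (1 + t) ^ (d + k) := by gcongr; exact hC t ht _ (hf i)
    _ = C * weight N t (f i) ^ m₁ := by
        rw [mul_assoc, one_div_zpow_mul_pow ht, mul_one, zpow_natCast]
    _ ≤ |C| * weight N t (f i) ^ m₁ := by gcongr; exact le_abs_self C
    _ ≤ |C| * r := by gcongr; exact hr i t ht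

theorem IsSymbol.tsymbol {d : ℕ} (hN : 0 < N) {a : ℝ → EuclideanSpace ℝ (Fin n) → ℂ}
    (ha : IsSymbol N 0 d a) :
    TSymbol d (fun (x : {ξ : EuclideanSpace ℝ (Fin n) // ξ ≠ 0}) t => a t x) :=
  ha.tsymbol_of_weight_le (m₁ := 0) hN _ (fun x => x.2) (r := 1) (by simp)

theorem TSymbol.isSymbol {a : ℝ → EuclideanSpace ℝ (Fin n) → ℂ}
    (ha : TSymbol 0 (fun (x : {ξ : EuclideanSpace ℝ (Fin n) // ξ ≠ 0}) t => a t x)) :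
    IsSymbol N 0 0 a := by
  refine ⟨fun ξ hξ => ha.contDiffOn ⟨ξ, hξ⟩, fun k => ?_⟩
  obtain ⟨C, hC⟩ := ha.iteratedDerivWithin_bound k
  refine ⟨C, fun t ht ξ hξ => ?_⟩
  have h1 := hC ⟨ξ, hξ⟩ t ht
  have h2 : (1 / (1 + t)) ^ ((0 : ℤ) + (k : ℤ)) * (1 + t) ^ (0 + k) = 1 := by
    exact_mod_cast one_div_zpow_mul_pow ht 0 k
  have h3 : 0 ≤ (1 / (1 + t)) ^ ((0 : ℤ) + (k : ℤ)) := by positivity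
  rw [zpow_zero, mul_one]
  calc _ = (‖iteratedDerivWithin k (fun τ => a τ ξ) (Ici 0) t‖ * (1 + t) ^ (0 + k)) *
        (1 / (1 + t)) ^ ((0 : ℤ) + (k : ℤ)) := by
        rw [mul_assoc, mul_comm ((1 + t) ^ (0 + k)), h2, mul_one]
    _ ≤ _ := by gcongr

/-- On a sphere of radius at least `N` the weight is constant. -/
theorem IsSymbol.tsymbol_sphere {ι : Type*} (hN : 0 < N) {m₁ d : ℕ}
    {a : ℝ → EuclideanSpace ℝ (Fin n) → ℂ} (ha : IsSymbol N m₁ d a)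
    (f : ι → EuclideanSpace ℝ (Fin n)) {r : ℝ} (hr : N ≤ r) (hf : ∀ i, ‖f i‖ = r) :
    TSymbol d (fun i t => a t (f i)) := by
  refine ha.tsymbol_of_weight_le hN f (fun i => ?_) (r := r ^ m₁) fun i t ht => ?_
  · rw [← norm_ne_zero_iff, hf i]
    linarith
  · rw [weight, hf i, max_eq_left]
    exact (div_le_self hN.le (by linarith)).trans hr

end IsSymbol

/-! ### Differential inequalities and linear differential equations on a half-line -/

section ODE

/-- Both `φ - f` and `φ + f` are monotone. No integrability of `f'` is involved, and the two times
may come in either order. -/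
theorem abs_sub_le_of_abs_deriv_le {D : Set ℝ} (hD : Convex ℝ D) {f f' φ φ' : ℝ → ℝ}
    (hf : ∀ t ∈ D, HasDerivWithinAt f (f' t) D t)
    (hφ : ∀ t ∈ D, HasDerivWithinAt φ (φ' t) D t)
    (hb : ∀ t ∈ D, |f' t| ≤ φ' t) {s t : ℝ} (hs : s ∈ D) (ht : t ∈ D) :
    |f t - f s| ≤ |φ t - φ s| := by
  have h1 : MonotoneOn (fun t => φ t - f t) D := by
    refine monotoneOn_of_hasDerivWithinAt_nonneg (f' := fun t => φ' t - f' t) hD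
      (fun t ht => ((hφ t ht).sub (hf t ht)).continuousWithinAt) (fun t ht => ?_) fun t ht => ?_
    · have ht' := interior_subset ht
      exact ((hφ t ht').sub (hf t ht')).mono interior_subset
    · linarith [(abs_le.1 (hb t (interior_subset ht))).2]
  have h2 : MonotoneOn (fun t => φ t + f t) D := by
    refine monotoneOn_of_hasDerivWithinAt_nonneg (f' := fun t => φ' t + f' t) hD
      (fun t ht => ((hφ t ht).add (hf t ht)).continuousWithinAt) (fun t ht => ?_) fun t ht => ?_
    · have ht' := interior_subset ht
      exact ((hφ t ht').add (hf t ht')).mono interior_subset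
    · linarith [(abs_le.1 (hb t (interior_subset ht))).1]
  rcases le_total s t with hst | hst
  · have e1 := h1 hs ht hst
    have e2 := h2 hs ht hst
    simp only at e1 e2
    exact (abs_le.2 ⟨by linarith, by linarith⟩).trans (le_abs_self _)
  · have e1 := h1 ht hs hst
    have e2 := h2 ht hs hst
    simp only at e1 e2
    exact (abs_le.2 ⟨by linarith, by linarith⟩).trans (neg_le_abs _)

/-- Gronwall's inequality in both time directions: `f exp(φ)` increases and `f exp(-φ)` decreases.
-/
theorem le_exp_mul_of_abs_deriv_le {a : ℝ} {f f' φ φ' : ℝ → ℝ}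
    (hf : ∀ t, a ≤ t → HasDerivWithinAt f (f' t) (Ici a) t)
    (hφ : ∀ t, a ≤ t → HasDerivWithinAt φ (φ' t) (Ici a) t)
    (hf0 : ∀ t, a ≤ t → 0 ≤ f t)
    (hb : ∀ t, a ≤ t → |f' t| ≤ φ' t * f t) {s t : ℝ} (hs : a ≤ s) (ht : a ≤ t) :
    f t ≤ Real.exp |φ t - φ s| * f s := by
  have d1 : ∀ t, a ≤ t → HasDerivWithinAt (fun t => f t * Real.exp (φ t))
      (f' t * Real.exp (φ t) + f t * (Real.exp (φ t) * φ' t)) (Ici a) t := fun t ht =>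
    (hf t ht).mul (hφ t ht).exp
  have d2 : ∀ t, a ≤ t → HasDerivWithinAt (fun t => f t * Real.exp (-φ t))
      (f' t * Real.exp (-φ t) + f t * (Real.exp (-φ t) * -φ' t)) (Ici a) t := fun t ht =>
    (hf t ht).mul (hφ t ht).neg.exp
  have h1 : MonotoneOn (fun t => f t * Real.exp (φ t)) (Ici a) := by
    refine monotoneOn_of_hasDerivWithinAt_nonneg (convex_Ici a)
      (fun t ht => (d1 t ht).continuousWithinAt)
      (fun t ht => (d1 t (interior_subset ht)).mono interior_subset) fun t ht => ?_
    have h := (abs_le.1 (hb t (interior_subset ht))).1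
    have : 0 ≤ (f' t + φ' t * f t) * Real.exp (φ t) := mul_nonneg (by linarith) (Real.exp_nonneg _)
    linarith
  have h2 : AntitoneOn (fun t => f t * Real.exp (-φ t)) (Ici a) := by
    refine antitoneOn_of_hasDerivWithinAt_nonpos (convex_Ici a)
      (fun t ht => (d2 t ht).continuousWithinAt)
      (fun t ht => (d2 t (interior_subset ht)).mono interior_subset) fun t ht => ?_
    have h := (abs_le.1 (hb t (interior_subset ht))).2
    have : 0 ≤ (φ' t * f t - f' t) * Real.exp (-φ t) := mul_nonneg (by linarith) (Real.exp_nonneg _)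
    linarith
  rcases le_total s t with hst | hst
  · have e := mul_le_mul_of_nonneg_right (h2 hs ht hst) (Real.exp_nonneg (φ t))
    simp only [mul_assoc, ← Real.exp_add] at e
    rw [neg_add_cancel, Real.exp_zero, mul_one, mul_comm] at e
    refine e.trans (mul_le_mul_of_nonneg_right (Real.exp_le_exp.2 ?_) (hf0 s hs))
    rw [neg_add_eq_sub]
    exact le_abs_self _
  · have e := mul_le_mul_of_nonneg_right (h1 ht hs hst) (Real.exp_nonneg (-φ t))
    simp only [mul_assoc, ← Real.exp_add] at e
    rw [add_neg_cancel, Real.exp_zero, mul_one, mul_comm] at e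
    refine e.trans (mul_le_mul_of_nonneg_right (Real.exp_le_exp.2 ?_) (hf0 s hs))
    rw [abs_sub_comm, ← sub_eq_add_neg]
    exact le_abs_self _

/-! ### Global existence for linear equations by a weighted contraction -/

variable {F : Type*} [NormedAddCommGroup F] [NormedSpace ℝ F]

/-- The exponential weight makes the Lipschitz constant of the Picard map `K / c`, independent of
the length of the interval, so a single contraction gives a solution on the whole half-line. -/
theorem norm_weighted_integral_le {c K D : ℝ} (hc : 0 < c) {g : ℝ → F} {t : ℝ} (ht : 0 ≤ t)
    (hg : ∀ s, ‖g s‖ ≤ Real.exp (c * s) * (K * D)) :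
    ‖Real.exp (-(c * t)) • ∫ s in (0 : ℝ)..t, g s‖ ≤ |K * D| / c := by
  have hint : ∫ s in (0 : ℝ)..t, Real.exp (c * s) * |K * D|
      = (Real.exp (c * t) - 1) / c * |K * D| := by
    have hd : ∀ s ∈ uIcc 0 t, HasDerivAt (fun s => Real.exp (c * s) / c * |K * D|)
        (Real.exp (c * s) * |K * D|) s := fun s _ => by
      have h1 : HasDerivAt (fun s => c * s) c s := by simpa using (hasDerivAt_id s).const_mul c
      refine ((h1.exp.div_const c).mul_const _).congr_deriv ?_
      field_simp
    rw [intervalIntegral.integral_eq_sub_of_hasDerivAt hd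
      (Continuous.intervalIntegrable (by fun_prop) _ _)]
    simp
    ring
  have h := intervalIntegral.norm_integral_le_of_norm_le (μ := MeasureTheory.volume)
    (f := g) (g := fun s => Real.exp (c * s) * |K * D|) ht
    (.of_forall fun s _ => (hg s).trans
      (mul_le_mul_of_nonneg_left (le_abs_self _) (Real.exp_nonneg _)))
    (Continuous.intervalIntegrable (by fun_prop) _ _)
  rw [hint] at h
  rw [norm_smul, Real.norm_eq_abs, Real.abs_exp]
  calc _ ≤ Real.exp (-(c * t)) * ((Real.exp (c * t) - 1) / c * |K * D|) := by gcongr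
    _ = (Real.exp (-(c * t)) * Real.exp (c * t) - Real.exp (-(c * t))) * (|K * D| / c) := by ring
    _ = (1 - Real.exp (-(c * t))) * (|K * D| / c) := by
        rw [← Real.exp_add, neg_add_cancel, Real.exp_zero]
    _ ≤ 1 * (|K * D| / c) := by
        gcongr
        linarith [Real.exp_pos (-(c * t))]
    _ = _ := one_mul _

open scoped BoundedContinuousFunction in
/-- Global solvability of linear equations with bounded continuous coefficients on `[0, ∞)`. -/
theorem exists_linear_ode_solution [CompleteSpace F] (B : ℝ → F →L[ℝ] F)
    (hB : ContinuousOn B (Ici 0)) {K : ℝ} (hK : ∀ t, 0 ≤ t → ‖B t‖ ≤ K) (x₀ : F) :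
    ∃ w : ℝ → F, w 0 = x₀ ∧ ∀ t, 0 ≤ t → HasDerivWithinAt w (B t (w t)) (Ici 0) t := by
  have hK0 : 0 ≤ K := (norm_nonneg _).trans (hK 0 le_rfl)
  -- This choice gives `K / c ≤ 1/2`.
  set c : ℝ := 2 * (K + 1) with hc
  have hc0 : 0 < c := by positivity
  set Bx : ℝ → F →L[ℝ] F := fun t => B (max t 0) with hBx
  have hBc : Continuous Bx :=
    hB.comp_continuous (by fun_prop) fun t => le_max_right t 0
  have hBK : ∀ t, ‖Bx t‖ ≤ K := fun t => hK _ (le_max_right t 0)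
  have hgc : ∀ z : ℝ →ᵇ F, Continuous fun s => Real.exp (c * s) • Bx s (z s) := fun z =>
    Continuous.smul (by fun_prop) (hBc.clm_apply z.continuous)
  have hgb : ∀ (z : ℝ →ᵇ F) s, ‖Real.exp (c * s) • Bx s (z s)‖ ≤ Real.exp (c * s) * (K * ‖z‖) :=
    fun z s => by
      rw [norm_smul, Real.norm_eq_abs, Real.abs_exp]
      gcongr
      exact (Bx s).le_of_opNorm_le_of_le (hBK s) (z.norm_coe_le_norm s)
  -- The Picard map written for `z = exp(-c t) w`. Clamping time at `0` extends everything to the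
  -- line, where the complete space of bounded continuous functions is available.
  set Φ : (ℝ →ᵇ F) → ℝ → F := fun z t => Real.exp (-(c * max t 0)) • x₀ +
    Real.exp (-(c * max t 0)) • ∫ s in (0 : ℝ)..max t 0, Real.exp (c * s) • Bx s (z s) with hΦ
  have hΦc : ∀ z, Continuous (Φ z) := fun z => by
    have h1 : Continuous fun t => ∫ s in (0 : ℝ)..t, Real.exp (c * s) • Bx s (z s) :=
      intervalIntegral.continuous_primitive (fun a b => (hgc z).intervalIntegrable a b) 0
    have h2 := h1.comp (continuous_id.max continuous_const : Continuous fun t : ℝ => max t 0)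
    have h3 : Continuous fun t : ℝ => Real.exp (-(c * max t 0)) := by fun_prop
    exact (h3.smul continuous_const).add (h3.smul h2)
  have hΦb : ∀ z t, ‖Φ z t‖ ≤ ‖x₀‖ + |K * ‖z‖| / c := fun z t => by
    have ht : 0 ≤ max t 0 := le_max_right t 0
    refine (norm_add_le _ _).trans (add_le_add ?_ ?_)
    · rw [norm_smul, Real.norm_eq_abs, Real.abs_exp]
      refine mul_le_of_le_one_left (norm_nonneg _) (Real.exp_le_one_iff.2 ?_)
      have := mul_nonneg hc0.le ht
      linarith
    · exact norm_weighted_integral_le hc0 ht (hgb z)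
  set T : (ℝ →ᵇ F) → (ℝ →ᵇ F) := fun z =>
    BoundedContinuousFunction.ofNormedAddCommGroup (Φ z) (hΦc z) _ (hΦb z) with hT
  have hcon : ContractingWith (1 / 2) T := by
    refine ⟨by rw [← NNReal.coe_lt_coe]; norm_num, LipschitzWith.of_dist_le_mul fun z y => ?_⟩
    refine (BoundedContinuousFunction.dist_le (by positivity)).2 fun t => ?_
    have ht : 0 ≤ max t 0 := le_max_right t 0
    have e : Φ z t - Φ y t = Real.exp (-(c * max t 0)) •
        ∫ s in (0 : ℝ)..max t 0, Real.exp (c * s) • Bx s ((z - y) s) := by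
      simp only [hΦ, add_sub_add_left_eq_sub, ← smul_sub]
      rw [← intervalIntegral.integral_sub ((hgc z).intervalIntegrable _ _)
        ((hgc y).intervalIntegrable _ _)]
      simp [← smul_sub]
    change dist (Φ z t) (Φ y t) ≤ _
    rw [dist_eq_norm, e, dist_eq_norm]
    refine (norm_weighted_integral_le hc0 ht (hgb (z - y))).trans ?_
    rw [abs_of_nonneg (by positivity), div_le_iff₀ hc0, hc]
    push_cast
    nlinarith [norm_nonneg (z - y)]
  obtain ⟨z, hz⟩ : ∃ z, T z = z := ⟨hcon.fixedPoint, hcon.fixedPoint_isFixedPt⟩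
  set w : ℝ → F := fun t => x₀ + ∫ s in (0 : ℝ)..t, Real.exp (c * s) • Bx s (z s) with hw
  have hwz : ∀ t, 0 ≤ t → w t = Real.exp (c * t) • z t := fun t ht => by
    have h1 : z t = Φ z t := (congrArg (fun y : ℝ →ᵇ F => y t) hz).symm
    rw [h1]
    simp only [hΦ, max_eq_left ht, ← smul_add, smul_smul, ← Real.exp_add, add_neg_cancel,
      Real.exp_zero, one_smul, hw]
  refine ⟨w, by simp [hw], fun t ht => ?_⟩
  have h1 : HasDerivAt w (Real.exp (c * t) • Bx t (z t)) t :=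
    (intervalIntegral.integral_hasDerivAt_right ((hgc z).intervalIntegrable _ _)
      ((hgc z).stronglyMeasurableAtFilter _ _) (hgc z).continuousAt).const_add x₀
  rw [hwz t ht, map_smul]
  have h2 : B t = Bx t := by simp [hBx, max_eq_left ht]
  rw [h2]
  exact h1.hasDerivWithinAt

/-! ### Complex systems and Gronwall bounds for the squared norm -/

variable {m : ℕ}

theorem exists_matrix_ode_solution (Q : ℝ → Matrix (Fin m) (Fin m) ℂ)
    (hQ : ∀ a b, ContinuousOn (fun t => Q t a b) (Ici 0)) {K : ℝ}
    (hK : ∀ t, 0 ≤ t → ∀ a b, ‖Q t a b‖ ≤ K) (x₀ : Fin m → ℂ) :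
    ∃ w : ℝ → Fin m → ℂ, w 0 = x₀ ∧ ∀ t, 0 ≤ t → ∀ a,
      HasDerivWithinAt (fun τ => w τ a) ((Q t *ᵥ w t) a) (Ici 0) t := by
  set T : Fin m → Fin m → (Fin m → ℂ) →L[ℝ] (Fin m → ℂ) := fun a b =>
    (ContinuousLinearMap.single ℝ (fun _ => ℂ) a).comp (ContinuousLinearMap.proj b) with hT
  obtain ⟨w, hw0, hw⟩ := exists_linear_ode_solution
    (fun t => ∑ a, ∑ b, Q t a b • T a b)
    (continuousOn_finsetSum _ fun a _ => continuousOn_finsetSum _ fun b _ =>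
      (hQ a b).smul continuousOn_const)
    (K := ∑ a, ∑ b, K * ‖T a b‖) (fun t ht => by
      refine norm_sum_le_of_le _ fun a _ => norm_sum_le_of_le _ fun b _ => ?_
      rw [norm_smul]
      gcongr
      exact hK t ht a b) x₀
  refine ⟨w, hw0, fun t ht a => ?_⟩
  refine ((hasDerivWithinAt_pi.1 (hw t ht)) a).congr_deriv ?_
  simp [hT, Matrix.mulVec, dotProduct, Finset.sum_apply, Pi.single_apply]

/-- The squared Euclidean norm of a complex vector. -/
noncomputable def normSqSum (x : Fin m → ℂ) : ℝ := ∑ j, ‖x j‖ ^ 2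

theorem normSqSum_nonneg (x : Fin m → ℂ) : 0 ≤ normSqSum x :=
  Finset.sum_nonneg fun _ _ => by positivity

theorem norm_sq_le_normSqSum (x : Fin m → ℂ) (j : Fin m) : ‖x j‖ ^ 2 ≤ normSqSum x :=
  Finset.single_le_sum (f := fun j => ‖x j‖ ^ 2) (fun _ _ => by positivity) (Finset.mem_univ j)

theorem normSqSum_eq_zero {x : Fin m → ℂ} : normSqSum x = 0 ↔ x = 0 := by
  rw [normSqSum, Finset.sum_eq_zero_iff_of_nonneg fun _ _ => by positivity]
  simp [funext_iff]

theorem sq_sum_norm_le (x : Fin m → ℂ) : (∑ j, ‖x j‖) ^ 2 ≤ m * normSqSum x := by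
  simpa [normSqSum] using sq_sum_le_card_mul_sum_sq (s := Finset.univ) (f := fun j => ‖x j‖)

theorem hasDerivWithinAt_norm_sq {z : ℝ → ℂ} {z' : ℂ} {s : Set ℝ} {t : ℝ}
    (h : HasDerivWithinAt z z' s t) :
    HasDerivWithinAt (fun τ => ‖z τ‖ ^ 2) (2 * (star (z t) * z').re) s t := by
  refine h.norm_sq.congr_deriv ?_
  rw [real_inner_eq_re_inner ℂ]
  simp [mul_comm]

theorem hasDerivWithinAt_normSqSum {x : ℝ → Fin m → ℂ} {x' : Fin m → ℂ} {s : Set ℝ} {t : ℝ}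
    (h : ∀ j, HasDerivWithinAt (fun τ => x τ j) (x' j) s t) :
    HasDerivWithinAt (fun τ => normSqSum (x τ)) (∑ j, 2 * (star (x t j) * x' j).re) s t :=
  HasDerivWithinAt.fun_sum fun j _ => hasDerivWithinAt_norm_sq (h j)

theorem abs_sum_two_mul_re_le {x y : Fin m → ℂ} {κ : ℝ}
    (hy : ∀ j, ‖y j‖ ≤ κ * ∑ k, ‖x k‖) :
    |∑ j, 2 * (star (x j) * y j).re| ≤ 2 * κ * (∑ k, ‖x k‖) ^ 2 := by
  refine (Finset.abs_sum_le_sum_abs _ _).trans ?_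
  calc _ ≤ ∑ j, ‖x j‖ * (2 * (κ * ∑ k, ‖x k‖)) := by
        refine Finset.sum_le_sum fun j _ => ?_
        rw [abs_mul, abs_two]
        have h1 := Complex.abs_re_le_norm (star (x j) * y j)
        rw [norm_mul, norm_star] at h1
        have h2 := mul_le_mul_of_nonneg_left (hy j) (norm_nonneg (x j))
        linarith
    _ = _ := by rw [← Finset.sum_mul]; ring

theorem norm_mulVec_apply_le {Q : Matrix (Fin m) (Fin m) ℂ} {κ : ℝ} (hQ : ∀ a b, ‖Q a b‖ ≤ κ)
    (x : Fin m → ℂ) (a : Fin m) : ‖(Q *ᵥ x) a‖ ≤ κ * ∑ k, ‖x k‖ := by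
  rw [Matrix.mulVec, dotProduct, Finset.mul_sum]
  refine norm_sum_le_of_le _ fun k _ => ?_
  rw [norm_mul]
  gcongr
  exact hQ a k

theorem normSqSum_mulVec_le {Q : Matrix (Fin m) (Fin m) ℂ} {κ : ℝ} (hQ : ∀ a b, ‖Q a b‖ ≤ κ)
    (x : Fin m → ℂ) : normSqSum (Q *ᵥ x) ≤ (m * κ) ^ 2 * normSqSum x := by
  calc normSqSum (Q *ᵥ x) ≤ ∑ _j : Fin m, (κ * ∑ k, ‖x k‖) ^ 2 := by
        refine Finset.sum_le_sum fun j _ => ?_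
        gcongr
        exact norm_mulVec_apply_le hQ x j
    _ = m * κ ^ 2 * (∑ k, ‖x k‖) ^ 2 := by simp; ring
    _ ≤ m * κ ^ 2 * (m * normSqSum x) := by gcongr; exact sq_sum_norm_le x
    _ = _ := by ring

/-- Two-sided Gronwall estimate for `x' = Q x` with bounded coefficients. -/
theorem normSqSum_le_exp_mul {Q : ℝ → Matrix (Fin m) (Fin m) ℂ} {κ : ℝ}
    (hQ : ∀ t, 0 ≤ t → ∀ a b, ‖Q t a b‖ ≤ κ) {x : ℝ → Fin m → ℂ}
    (hx : ∀ t, 0 ≤ t → ∀ a, HasDerivWithinAt (fun τ => x τ a) ((Q t *ᵥ x t) a) (Ici 0) t)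
    (hκ : 0 ≤ κ) {s t : ℝ} (hs : 0 ≤ s) (ht : 0 ≤ t) :
    normSqSum (x t) ≤ Real.exp |2 * κ * m * t - 2 * κ * m * s| * normSqSum (x s) := by
  refine le_exp_mul_of_abs_deriv_le (φ := fun t => 2 * κ * m * t)
    (fun t ht => hasDerivWithinAt_normSqSum (hx t ht))
    (fun t _ => ((hasDerivAt_id t).const_mul (2 * κ * m)).hasDerivWithinAt)
    (fun t _ => normSqSum_nonneg _) (fun t ht => ?_) hs ht
  refine (abs_sum_two_mul_re_le (norm_mulVec_apply_le (hQ t ht) (x t))).trans ?_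
  have := mul_le_mul_of_nonneg_left (sq_sum_norm_le (x t)) (by positivity : 0 ≤ 2 * κ)
  linarith

end ODE

/-! ### Matrix-valued symbols and normalised sections of projection-valued symbols -/

section MatrixSymbol

variable {ι : Type*} {m : ℕ}

/-- Matrix-valued symbols of order `-d` in `1 + t`, uniform over the index set. -/
def MSymbol (d : ℕ) (P : ι → ℝ → Matrix (Fin m) (Fin m) ℂ) : Prop :=
  ∀ a b, TSymbol d (fun i t => P i t a b)

/-- The entrywise one-sided time derivative. -/
noncomputable def matDeriv (P : ℝ → Matrix (Fin m) (Fin m) ℂ) (t : ℝ) :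
    Matrix (Fin m) (Fin m) ℂ :=
  Matrix.of fun a b => derivWithin (fun τ => P τ a b) (Ici 0) t

namespace MSymbol

variable {d e : ℕ} {P Q : ι → ℝ → Matrix (Fin m) (Fin m) ℂ}

theorem hasDeriv (h : MSymbol d P) (i : ι) {t : ℝ} (ht : 0 ≤ t) (a b : Fin m) :
    HasDerivWithinAt (fun τ => P i τ a b) (matDeriv (P i) t a b) (Ici 0) t :=
  (h a b).hasDeriv i ht

theorem deriv (h : MSymbol d P) : MSymbol (d + 1) (fun i => matDeriv (P i)) :=
  fun a b => (h a b).deriv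

theorem congr (h : MSymbol d P) (hPQ : ∀ i t, 0 ≤ t → P i t = Q i t) : MSymbol d Q :=
  fun a b => (h a b).congr fun i t ht => by rw [hPQ i t ht]

theorem mul (hP : MSymbol d P) (hQ : MSymbol e Q) : MSymbol (d + e) (fun i t => P i t * Q i t) :=
  fun a b => by
    simp only [Matrix.mul_apply]
    exact TSymbol.sum _ fun k _ => (hP a k).mul (hQ k b)

theorem sub (hP : MSymbol d P) (hQ : MSymbol d Q) : MSymbol d (fun i t => P i t - Q i t) :=
  fun a b => (hP a b).sub (hQ a b)

theorem smul {f : ι → ℝ → ℂ} (hf : TSymbol d f) (hP : MSymbol e P) :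
    MSymbol (d + e) (fun i t => f i t • P i t) :=
  fun a b => hf.mul (hP a b)

theorem const_smul (c : ℂ) (hP : MSymbol d P) : MSymbol d (fun i t => c • P i t) :=
  fun a b => (hP a b).const_mul c

theorem one : MSymbol 0 (fun (_ : ι) (_ : ℝ) => (1 : Matrix (Fin m) (Fin m) ℂ)) :=
  fun a b => TSymbol.const (fun _ => (1 : Matrix (Fin m) (Fin m) ℂ) a b) ⟨_, fun _ => le_rfl⟩

theorem diagonal {f : Fin m → ι → ℝ → ℂ} (hf : ∀ j, TSymbol d (f j)) :
    MSymbol d (fun i t => Matrix.diagonal fun j => f j i t) := fun a b => by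
  by_cases h : a = b
  · subst h
    simpa using hf a
  · simpa [Matrix.diagonal_apply_ne _ h] using TSymbol.zero d

/-- A common bound for all entries. -/
theorem bound (hP : MSymbol d P) : ∃ C : ℝ, 0 ≤ C ∧ ∀ i t, 0 ≤ t → ∀ a b,
    ‖P i t a b‖ * (1 + t) ^ d ≤ C := by
  choose C hC using fun a b => (hP a b).decays
  refine ⟨∑ a, ∑ b, |C a b|, by positivity, fun i t ht a b => (hC a b i t ht).trans ?_⟩
  refine (le_abs_self _).trans ?_
  refine (Finset.single_le_sum (f := fun b => |C a b|) (fun _ _ => abs_nonneg _)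
    (Finset.mem_univ b)).trans ?_
  exact Finset.single_le_sum (f := fun a => ∑ b, |C a b|)
    (fun _ _ => Finset.sum_nonneg fun _ _ => abs_nonneg _) (Finset.mem_univ a)

theorem bound' (hP : MSymbol d P) : ∃ C : ℝ, 0 ≤ C ∧ ∀ i t, 0 ≤ t → ∀ a b, ‖P i t a b‖ ≤ C := by
  obtain ⟨C, hC0, hC⟩ := hP.bound
  refine ⟨C, hC0, fun i t ht a b => le_trans ?_ (hC i t ht a b)⟩
  exact le_mul_of_one_le_right (norm_nonneg _) (one_le_pow₀ (by linarith))

theorem matDeriv_mul (hP : MSymbol d P) (hQ : MSymbol e Q) (i : ι) {t : ℝ} (ht : 0 ≤ t) :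
    matDeriv (fun τ => P i τ * Q i τ) t
      = matDeriv (P i) t * Q i t + P i t * matDeriv (Q i) t := by
  ext a b
  have h : HasDerivWithinAt (fun τ => (P i τ * Q i τ) a b)
      (∑ k, (matDeriv (P i) t a k * Q i t k b + P i t a k * matDeriv (Q i) t k b)) (Ici 0) t := by
    simp only [Matrix.mul_apply]
    exact HasDerivWithinAt.fun_sum fun k _ => (hP.hasDeriv i ht a k).mul (hQ.hasDeriv i ht k b)
  rw [matDeriv, Matrix.of_apply, h.derivWithin (uniqueDiff_Ici ht)]
  simp [Matrix.mul_apply, Finset.sum_add_distrib]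

end MSymbol

theorem matDeriv_congr {P Q : ℝ → Matrix (Fin m) (Fin m) ℂ} (h : ∀ t, 0 ≤ t → P t = Q t)
    {t : ℝ} (ht : 0 ≤ t) : matDeriv P t = matDeriv Q t := by
  ext a b
  exact derivWithin_congr (fun s hs => by simp only [h s hs]) (by simp only [h t ht])

theorem TSymbolUpTo.sum {k d : ℕ} {α : Type*} (s : Finset α) {f : α → ι → ℝ → ℂ}
    (h : ∀ x ∈ s, TSymbolUpTo k d (f x)) : TSymbolUpTo k d (fun i t => ∑ x ∈ s, f x i t) := by
  classical
  induction s using Finset.induction_on with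
  | empty => simpa using TSymbolUpTo.zero k d
  | insert x s hx ih =>
    simp only [Finset.sum_insert hx]
    exact (h x (by simp)).add (ih fun y hy => h y (by simp [hy]))

theorem TSymbolUpTo.const_mul {k d : ℕ} {f : ι → ℝ → ℂ} (h : TSymbolUpTo k d f) (c : ℂ) :
    TSymbolUpTo k d (fun i t => c * f i t) := by
  simpa using (TSymbol.const (fun _ : ι => c) ⟨‖c‖, fun _ => le_rfl⟩ k).mul h

theorem hasDerivWithinAt_mulVec {P : ℝ → Matrix (Fin m) (Fin m) ℂ}
    {P' : Matrix (Fin m) (Fin m) ℂ} {w : ℝ → Fin m → ℂ} {w' : Fin m → ℂ} {s : Set ℝ} {t : ℝ}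
    (hP : ∀ a b, HasDerivWithinAt (fun τ => P τ a b) (P' a b) s t)
    (hw : ∀ a, HasDerivWithinAt (fun τ => w τ a) (w' a) s t) (a : Fin m) :
    HasDerivWithinAt (fun τ => (P τ *ᵥ w τ) a) ((P' *ᵥ w t + P t *ᵥ w') a) s t := by
  simp only [Matrix.mulVec, dotProduct, Pi.add_apply, ← Finset.sum_add_distrib]
  exact HasDerivWithinAt.fun_sum fun k _ => (hP a k).mul (hw k)

/-- Parallel transport: a nonzero solution of `w' = P' w` inside the range of `P`. -/
theorem exists_parallel_section {P : ι → ℝ → Matrix (Fin m) (Fin m) ℂ} (hP : MSymbol 0 P)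
    (hid : ∀ i t, 0 ≤ t → P i t * P i t = P i t) (h0 : ∀ i, P i 0 ≠ 0) (i : ι) :
    ∃ w : ℝ → Fin m → ℂ, ∀ t, 0 ≤ t → w t ≠ 0 ∧ P i t *ᵥ w t = w t ∧
      ∀ a, HasDerivWithinAt (fun τ => w τ a) ((matDeriv (P i) t *ᵥ w t) a) (Ici 0) t := by
  obtain ⟨C, hC0, hC⟩ := hP.deriv.bound'
  obtain ⟨D, hD0, hD⟩ := (hP.mul hP.deriv).bound'
  obtain ⟨x, hx⟩ : ∃ x, P i 0 *ᵥ x ≠ 0 := by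
    by_contra! h
    exact h0 i (Matrix.ext_of_mulVec_single fun j => by rw [h, Matrix.zero_mulVec])
  obtain ⟨w, hw0, hw⟩ := exists_matrix_ode_solution (matDeriv (P i))
    (fun a b t ht => (hP.deriv.hasDeriv i ht a b).continuousWithinAt) (hC i) (P i 0 *ᵥ x)
  -- The defect `q = w - P w` solves the linear equation `q' = -P P' q` and vanishes at `0`, hence
  -- vanishes always. This rests on `P P' P = 0`, obtained by multiplying `P' = P' P + P P'` by `P`
  -- from the left.
  have hq : ∀ t, 0 ≤ t → ∀ a, HasDerivWithinAt (fun τ => (w τ - P i τ *ᵥ w τ) a)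
      (((-(P i t * matDeriv (P i) t)) *ᵥ (w t - P i t *ᵥ w t)) a) (Ici 0) t := by
    intro t ht a
    refine ((hw t ht a).sub
      (hasDerivWithinAt_mulVec (hP.hasDeriv i ht) (hw t ht) a)).congr_deriv ?_
    have h1 := hP.matDeriv_mul hP i ht
    rw [matDeriv_congr (hid i) ht] at h1
    have h2 : P i t * matDeriv (P i) t * P i t = 0 := by
      have h3 := congrArg (P i t * ·) h1
      simp only [mul_add, ← mul_assoc, hid i t ht] at h3
      simpa using h3
    have h4 : (-(P i t * matDeriv (P i) t)) *ᵥ (w t - P i t *ᵥ w t)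
        = -(P i t *ᵥ (matDeriv (P i) t *ᵥ w t)) := by
      rw [Matrix.mulVec_sub, Matrix.mulVec_mulVec, neg_mul, h2, neg_zero, Matrix.zero_mulVec,
        sub_zero, Matrix.neg_mulVec, Matrix.mulVec_mulVec]
    rw [h4]
    simp
  refine ⟨w, fun t ht => ⟨fun hwt => hx ?_, ?_, hw t ht⟩⟩
  -- Gronwall backwards from `t` to `0`: a zero of `w` would force `w 0 = 0`.
  · have h := normSqSum_le_exp_mul (hC i) hw hC0 ht le_rfl
    rw [hwt, normSqSum_eq_zero.2 rfl, mul_zero, hw0] at h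
    exact normSqSum_eq_zero.1 (h.antisymm (normSqSum_nonneg _))
  · have h := normSqSum_le_exp_mul (Q := fun t => -(P i t * matDeriv (P i) t)) (κ := D)
      (fun t ht a b => by simpa using hD i t ht a b) hq hD0 le_rfl ht
    have hz : w 0 - P i 0 *ᵥ w 0 = 0 := by
      rw [hw0, Matrix.mulVec_mulVec, hid i 0 le_rfl, sub_self]
    rw [hz, normSqSum_eq_zero.2 rfl, mul_zero] at h
    exact (sub_eq_zero.1 (normSqSum_eq_zero.1 (h.antisymm (normSqSum_nonneg _)))).symm

theorem star_dotProduct_self (x : Fin m → ℂ) : star x ⬝ᵥ x = (normSqSum x : ℂ) := by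
  simp [dotProduct, normSqSum, Complex.conj_mul']

/-- A projection-valued symbol has a normalised section that is a symbol. -/
theorem exists_unit_section {P : ι → ℝ → Matrix (Fin m) (Fin m) ℂ} (hP : MSymbol 0 P)
    (hid : ∀ i t, 0 ≤ t → P i t * P i t = P i t) (h0 : ∀ i, P i 0 ≠ 0) :
    ∃ v : ι → ℝ → Fin m → ℂ, (∀ a, TSymbol 0 (fun i t => v i t a)) ∧
      ∀ i t, 0 ≤ t → P i t *ᵥ v i t = v i t ∧ star (v i t) ⬝ᵥ v i t = 1 := by
  choose w hw using exists_parallel_section hP hid h0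
  set r : ι → ℝ → ℝ := fun i t => √(normSqSum (w i t)) with hr
  set v : ι → ℝ → Fin m → ℂ := fun i t => ((r i t)⁻¹ : ℂ) • w i t with hv
  have hpos : ∀ i t, 0 ≤ t → 0 < normSqSum (w i t) := fun i t ht =>
    (normSqSum_nonneg _).lt_of_ne' fun h => (hw i t ht).1 (normSqSum_eq_zero.1 h)
  have hr0 : ∀ i t, 0 ≤ t → 0 < r i t := fun i t ht => Real.sqrt_pos.2 (hpos i t ht)
  have hr2 : ∀ i t, r i t ^ 2 = normSqSum (w i t) := fun i t => Real.sq_sqrt (normSqSum_nonneg _)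
  have hwv : ∀ i t, 0 ≤ t → ∀ a, w i t a = r i t * v i t a := fun i t ht a => by
    have : (r i t : ℂ) ≠ 0 := by exact_mod_cast (hr0 i t ht).ne'
    simp [hv, this]
  have hunit : ∀ i t, 0 ≤ t → normSqSum (v i t) = 1 := fun i t ht => by
    have h1 : normSqSum (v i t) = (r i t)⁻¹ ^ 2 * normSqSum (w i t) := by
      simp [normSqSum, hv, mul_pow, Finset.mul_sum]
    rw [h1, ← hr2, ← mul_pow, inv_mul_cancel₀ (hr0 i t ht).ne', one_pow]
  -- `G = -Re (v* P' v)` is minus the logarithmic derivative of `r = |w|`. Therefore `v = w / r`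
  -- satisfies `v' = P' v + G v`, which no longer mentions `w`, whose size is not controlled
  -- uniformly in time and index.
  set G : ι → ℝ → ℂ := fun i t => ∑ b, ((-(1 / 2) : ℂ) *
    (star (v i t b) * ∑ c, matDeriv (P i) t b c * v i t c +
      star (star (v i t b) * ∑ c, matDeriv (P i) t b c * v i t c))) with hG
  have hderiv : ∀ i t, 0 ≤ t → ∀ a, HasDerivWithinAt (fun τ => v i τ a)
      (∑ c, matDeriv (P i) t a c * v i t c + G i t * v i t a) (Ici 0) t := by
    intro i t ht a
    have hrne : (r i t : ℂ) ≠ 0 := by exact_mod_cast (hr0 i t ht).ne'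
    have e1 : ∀ b, (matDeriv (P i) t *ᵥ w i t) b
        = r i t * ∑ c, matDeriv (P i) t b c * v i t c := fun b => by
      rw [Matrix.mulVec, dotProduct, Finset.mul_sum]
      exact Finset.sum_congr rfl fun c _ => by rw [hwv i t ht]; ring
    have e2 : ((∑ j, 2 * (star (w i t j) * (matDeriv (P i) t *ᵥ w i t) j).re : ℝ) : ℂ)
        = -2 * (r i t) ^ 2 * G i t := by
      rw [hG, Finset.mul_sum, Complex.ofReal_sum]
      refine Finset.sum_congr rfl fun b _ => ?_
      rw [e1, hwv i t ht b]
      have e3 : star ((r i t : ℂ) * v i t b) * (r i t * ∑ c, matDeriv (P i) t b c * v i t c)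
          = ((r i t ^ 2 : ℝ) : ℂ) * (star (v i t b) * ∑ c, matDeriv (P i) t b c * v i t c) := by
        rw [star_mul']
        simp only [Complex.star_def, Complex.conj_ofReal]
        push_cast
        ring
      rw [e3, Complex.re_ofReal_mul]
      have e4 : _ + star (star (v i t b) * ∑ c, matDeriv (P i) t b c * v i t c) = _ :=
        Complex.add_conj (star (v i t b) * ∑ c, matDeriv (P i) t b c * v i t c)
      rw [e4]
      push_cast
      ring
    have hd : HasDerivWithinAt (fun τ => (r i τ : ℂ)) (-r i t * G i t) (Ici 0) t := by
      refine ((hasDerivWithinAt_normSqSum (hw i t ht).2.2).sqrt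
        (hpos i t ht).ne').ofReal_comp.congr_deriv ?_
      rw [Complex.ofReal_div, e2]
      change _ / ((2 * r i t : ℝ) : ℂ) = _
      push_cast
      field_simp
    refine ((hd.fun_inv hrne).mul ((hw i t ht).2.2 a)).congr_deriv ?_
    rw [e1, hwv i t ht a]
    field_simp
    ring
  -- Bootstrap: `v` is bounded because it has length one, and `P'` has order one, so level `k` for
  -- `v` gives level `k` at order one for `v'`, hence level `k + 1` for `v`.
  have hsym : ∀ k, ∀ a, TSymbolUpTo k 0 (fun i t => v i t a) := by
    have hdec : ∀ a, Decays 0 (fun i t => v i t a) := fun a => ⟨1, fun i t ht => by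
      have h := norm_sq_le_normSqSum (v i t) a
      rw [hunit i t ht] at h
      simpa using (sq_le_one_iff₀ (norm_nonneg _)).1 h⟩
    intro k
    induction k with
    | zero => exact hdec
    | succ k ih =>
      intro a
      have hsum : ∀ b, TSymbolUpTo k 1 (fun i t => ∑ c, matDeriv (P i) t b c * v i t c) :=
        fun b => TSymbolUpTo.sum _ fun c _ => (hP.deriv b c k).mul (ih c)
      have hprod : ∀ b, TSymbolUpTo k 1
          (fun i t => star (v i t b) * ∑ c, matDeriv (P i) t b c * v i t c) := fun b => by
        simpa using (ih b).conj.mul (hsum b)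
      refine .of_hasDeriv (hdec a) (fun i t ht => hderiv i t ht a) ((hsum a).add ?_)
      exact (TSymbolUpTo.sum _ fun b _ =>
        ((hprod b).add (hprod b).conj).const_mul _).mul (ih a)
  refine ⟨v, fun a k => hsym k a, fun i t ht => ⟨?_, ?_⟩⟩
  · rw [hv, Matrix.mulVec_smul, (hw i t ht).2.1]
  · rw [star_dotProduct_self, hunit i t ht, Complex.ofReal_one]

end MatrixSymbol

/-! ### Matrices with simple spectrum -/

section SimpleSpectrum

variable {m : ℕ}

theorem exists_eigenbasis {B : Matrix (Fin m) (Fin m) ℂ} {μ : Fin m → ℂ}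
    (hμ : Function.Injective μ) (hB : spectrum ℂ B = range μ) :
    ∃ S : Matrix (Fin m) (Fin m) ℂ, IsUnit S ∧ B * S = S * Matrix.diagonal μ := by
  have hev : ∀ j, ∃ x, Module.End.HasEigenvector (Matrix.toLin' B) (μ j) x := fun j => by
    have h : μ j ∈ spectrum ℂ (Matrix.toLin' B) := by
      rw [Matrix.spectrum_toLin', hB]
      exact mem_range_self j
    exact (Module.End.hasEigenvalue_iff_mem_spectrum.2 h).exists_hasEigenvector
  choose x hx using hev
  have hli := Module.End.eigenvectors_linearIndependent' (Matrix.toLin' B) μ hμ x hx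
  refine ⟨Matrix.of fun a j => x j a, ?_, ?_⟩
  · rw [← Matrix.isUnit_transpose, ← Matrix.linearIndependent_rows_iff_isUnit]
    exact hli
  · ext a j
    have h := congrFun (hx j).apply_eq_smul a
    rw [Matrix.toLin'_apply] at h
    rw [Matrix.mul_diagonal, Matrix.of_apply, mul_comm]
    exact h

theorem aeval_diagonal (μ : Fin m → ℂ) (p : Polynomial ℂ) :
    Polynomial.aeval (Matrix.diagonal μ) p = Matrix.diagonal fun i => p.eval (μ i) := by
  induction p using Polynomial.induction_on' with
  | add p q hp hq => rw [map_add, hp, hq, Matrix.diagonal_add]; simp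
  | monomial k c =>
    rw [Polynomial.aeval_monomial, Matrix.diagonal_pow, Matrix.algebraMap_eq_diagonal,
      Matrix.diagonal_mul_diagonal]
    simp

theorem aeval_mul_of_intertwine {B S D : Matrix (Fin m) (Fin m) ℂ} (h : B * S = S * D)
    (p : Polynomial ℂ) : Polynomial.aeval B p * S = S * Polynomial.aeval D p := by
  have hpow : ∀ k : ℕ, B ^ k * S = S * D ^ k := fun k => by
    induction k with
    | zero => simp
    | succ k ih => rw [pow_succ, mul_assoc, h, ← mul_assoc, ih, mul_assoc, ← pow_succ]
  induction p using Polynomial.induction_on' with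
  | add p q hp hq => rw [map_add, map_add, add_mul, mul_add, hp, hq]
  | monomial k c =>
    simp only [Polynomial.aeval_monomial, Algebra.algebraMap_eq_smul_one, smul_mul_assoc, one_mul,
      mul_smul_comm, hpow]

/-- The spectral projection of `B` for the simple eigenvalue `μ j`. -/
noncomputable def specProj (B : Matrix (Fin m) (Fin m) ℂ) (μ : Fin m → ℂ) (j : Fin m) :
    Matrix (Fin m) (Fin m) ℂ :=
  Polynomial.aeval B (Lagrange.basis Finset.univ μ j)

variable {B : Matrix (Fin m) (Fin m) ℂ} {μ : Fin m → ℂ}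

/-- In an eigenbasis `B` acts as `diag μ`, and the `j`-th Lagrange polynomial is `1` at `μ j` and
`0` at the other nodes. The algebraic identities for the projections follow by cancelling `S`. -/
theorem specProj_mul_eigenbasis (hμ : Function.Injective μ) {S : Matrix (Fin m) (Fin m) ℂ}
    (hS : B * S = S * Matrix.diagonal μ) (j : Fin m) :
    specProj B μ j * S = S * Matrix.diagonal (Pi.single j 1) := by
  rw [specProj, aeval_mul_of_intertwine hS, aeval_diagonal]
  congr 2
  ext i
  by_cases h : i = j
  · subst h
    rw [Lagrange.eval_basis_self hμ.injOn (Finset.mem_univ i), Pi.single_eq_same]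
  · rw [Lagrange.eval_basis_of_ne (Ne.symm h) (Finset.mem_univ i), Pi.single_eq_of_ne h]

theorem specProj_mul_self (hμ : Function.Injective μ) (hB : spectrum ℂ B = range μ) (j : Fin m) :
    specProj B μ j * specProj B μ j = specProj B μ j := by
  obtain ⟨S, hS, h⟩ := exists_eigenbasis hμ hB
  have hP := specProj_mul_eigenbasis hμ h j
  rw [← hS.mul_left_inj, mul_assoc, hP, ← mul_assoc, hP, mul_assoc, Matrix.diagonal_mul_diagonal]
  congr 2
  ext i
  by_cases hi : i = j
  · subst hi
    simp
  · simp [hi]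

theorem specProj_mul_of_ne (hμ : Function.Injective μ) (hB : spectrum ℂ B = range μ)
    {j k : Fin m} (hjk : j ≠ k) : specProj B μ j * specProj B μ k = 0 := by
  obtain ⟨S, hS, h⟩ := exists_eigenbasis hμ hB
  rw [← hS.mul_left_inj, mul_assoc, specProj_mul_eigenbasis hμ h, ← mul_assoc,
    specProj_mul_eigenbasis hμ h, mul_assoc, Matrix.diagonal_mul_diagonal, zero_mul]
  convert mul_zero S
  rw [Matrix.diagonal_eq_zero]
  ext i
  by_cases hi : i = j
  · subst hi
    simp [hjk]
  · simp [hi]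

theorem mul_specProj (hμ : Function.Injective μ) (hB : spectrum ℂ B = range μ) (j : Fin m) :
    B * specProj B μ j = μ j • specProj B μ j := by
  obtain ⟨S, hS, h⟩ := exists_eigenbasis hμ hB
  rw [← hS.mul_left_inj, mul_assoc, smul_mul_assoc, specProj_mul_eigenbasis hμ h, ← mul_assoc, h,
    mul_assoc, Matrix.diagonal_mul_diagonal, ← mul_smul_comm, ← Matrix.diagonal_smul]
  congr 2
  ext i
  by_cases hi : i = j
  · subst hi
    simp
  · simp [hi]

theorem specProj_ne_zero (hμ : Function.Injective μ) (hB : spectrum ℂ B = range μ) (j : Fin m) :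
    specProj B μ j ≠ 0 := by
  obtain ⟨S, hS, h⟩ := exists_eigenbasis hμ hB
  intro h0
  have h1 := specProj_mul_eigenbasis hμ h j
  rw [h0, zero_mul, eq_comm, hS.mul_right_eq_zero, Matrix.diagonal_eq_zero] at h1
  simpa using congrFun h1 j

theorem trace_pow_eq_sum (hμ : Function.Injective μ) (hB : spectrum ℂ B = range μ) (k : ℕ) :
    (B ^ k).trace = ∑ i, μ i ^ k := by
  obtain ⟨S, hS, h⟩ := exists_eigenbasis hμ hB
  have h1 := aeval_mul_of_intertwine h (Polynomial.X ^ k)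
  simp only [map_pow, Polynomial.aeval_X, Matrix.diagonal_pow] at h1
  have hdet := (Matrix.isUnit_iff_isUnit_det S).1 hS
  have h2 : B ^ k = S * Matrix.diagonal (μ ^ k) * S⁻¹ := by
    rw [← h1, Matrix.mul_nonsing_inv_cancel_right _ _ hdet]
  rw [h2, Matrix.trace_mul_comm, ← mul_assoc, Matrix.nonsing_inv_mul _ hdet, one_mul,
    Matrix.trace_diagonal]
  simp

/-- The entries are power sums, so the matrix is `Vᵀ V` for the Vandermonde matrix `V`. The left
side is polynomial in the entries of `B`: the discriminant is continuous even if nothing is known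
about continuity of the eigenvalues. -/
theorem det_hankel_trace (hμ : Function.Injective μ) (hB : spectrum ℂ B = range μ) :
    (Matrix.of fun a b : Fin m => (B ^ ((a : ℕ) + (b : ℕ))).trace).det
      = (Matrix.vandermonde μ).det ^ 2 := by
  have hsq : (Matrix.vandermonde μ).det ^ 2
      = ((Matrix.vandermonde μ)ᵀ * Matrix.vandermonde μ).det := by
    rw [Matrix.det_mul, Matrix.det_transpose, sq]
  rw [hsq]
  congr 1
  ext a b
  rw [Matrix.vandermonde_transpose_mul_vandermonde, Matrix.of_apply, trace_pow_eq_sum hμ hB]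

/-- Keep one factor of the product and bound each other one by `2Λ + 1`. Since this is at least `1`,
the crude count `m * m` of factors suffices. A lower bound for the discriminant thus becomes one for
each gap. -/
theorem norm_det_vandermonde_le {Λ : ℝ} (hΛ : ∀ i, ‖μ i‖ ≤ Λ) {i j : Fin m} (hij : i ≠ j) :
    ‖(Matrix.vandermonde μ).det‖ ≤ ‖μ i - μ j‖ * (2 * Λ + 1) ^ (m * m) := by
  wlog h : i < j generalizing i j
  · rw [norm_sub_rev]
    exact this hij.symm (lt_of_le_of_ne (not_lt.1 h) hij.symm)
  have hΛ0 : 0 ≤ Λ := (norm_nonneg _).trans (hΛ i)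
  set s : Finset ((_ : Fin m) × Fin m) := Finset.univ.sigma fun i => Finset.Ioi i with hs
  have hmem : (⟨i, j⟩ : (_ : Fin m) × Fin m) ∈ s := by simp [hs, h]
  rw [Matrix.det_vandermonde, norm_prod]
  simp only [norm_prod]
  rw [Finset.prod_sigma', ← Finset.mul_prod_erase s _ hmem, norm_sub_rev]
  gcongr
  refine (Finset.prod_le_prod (g := fun _ => 2 * Λ + 1) (fun _ _ => norm_nonneg _)
    fun x _ => ?_).trans ?_
  · have := norm_sub_le (μ x.2) (μ x.1)
    linarith [hΛ x.1, hΛ x.2]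
  · rw [Finset.prod_const]
    refine pow_le_pow_right₀ (by linarith) ?_
    refine (Finset.card_erase_le).trans ((Finset.card_le_univ _).trans ?_)
    simp

end SimpleSpectrum

/-- On a compact set, the eigenvalues of a continuous matrix function with simple spectrum are
uniformly separated. -/
theorem exists_gap_of_isCompact {X : Type*} [TopologicalSpace X] {K : Set X} (hK : IsCompact K)
    {m : ℕ} {B : X → Matrix (Fin m) (Fin m) ℂ} (hB : ∀ a b, ContinuousOn (fun x => B x a b) K)
    {μ : X → Fin m → ℂ} (hμ : ∀ x ∈ K, Function.Injective (μ x))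
    (hsp : ∀ x ∈ K, spectrum ℂ (B x) = range (μ x)) {Λ : ℝ} (hΛ : ∀ x ∈ K, ∀ i, ‖μ x i‖ ≤ Λ) :
    ∃ c : ℝ, 0 < c ∧ ∀ x ∈ K, ∀ i j, i ≠ j → c ≤ ‖μ x i - μ x j‖ := by
  rcases K.eq_empty_or_nonempty with rfl | hne
  · exact ⟨1, one_pos, by simp⟩
  rcases Nat.eq_zero_or_pos m with rfl | hm
  · exact ⟨1, one_pos, fun _ _ i => i.elim0⟩
  have hΛ0 : 0 ≤ Λ := by
    obtain ⟨x, hx⟩ := hne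
    exact (norm_nonneg _).trans (hΛ x hx ⟨0, hm⟩)
  have hBc : ContinuousOn B K := continuousOn_pi.2 fun a => continuousOn_pi.2 fun b => hB a b
  have hF : Continuous fun A : Matrix (Fin m) (Fin m) ℂ =>
      ‖(Matrix.of fun a b : Fin m => (A ^ ((a : ℕ) + (b : ℕ))).trace).det‖ := by
    refine (Continuous.matrix_det (continuous_matrix fun a b => ?_)).norm
    exact (continuous_pow _).matrix_trace
  -- The discriminant attains its minimal modulus on `K`, and this is positive because the spectrum
  -- at `x₀` is simple.
  obtain ⟨x₀, hx₀, hmin⟩ := hK.exists_isMinOn hne (hF.comp_continuousOn hBc)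
  have hdet : ∀ x ∈ K, ‖(Matrix.of fun a b : Fin m => ((B x) ^ ((a : ℕ) + (b : ℕ))).trace).det‖
      = ‖(Matrix.vandermonde (μ x)).det‖ ^ 2 := fun x hx => by
    rw [det_hankel_trace (hμ x hx) (hsp x hx), norm_pow]
  have hpos : 0 < ‖(Matrix.vandermonde (μ x₀)).det‖ :=
    norm_pos_iff.2 (Matrix.det_vandermonde_ne_zero_iff.2 (hμ x₀ hx₀))
  refine ⟨‖(Matrix.vandermonde (μ x₀)).det‖ / (2 * Λ + 1) ^ (m * m), by positivity,
    fun x hx i j hij => ?_⟩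
  rw [div_le_iff₀ (by positivity)]
  refine le_trans ?_ (norm_det_vandermonde_le (hΛ x hx) hij)
  have h := isMinOn_iff.1 hmin x hx
  simp only [Function.comp_apply] at h
  rw [hdet x hx, hdet x₀ hx₀] at h
  exact (pow_le_pow_iff_left₀ (norm_nonneg _) (norm_nonneg _) two_ne_zero).1 h

/-- Spectral projections of a symbol with uniformly separated eigenvalues are symbols. -/
theorem MSymbol.specProj {ι : Type*} {m : ℕ} {B : ι → ℝ → Matrix (Fin m) (Fin m) ℂ}
    (hB : MSymbol 0 B) {μ : ι → ℝ → Fin m → ℂ} (hμ : ∀ j, TSymbol 0 (fun i t => μ i t j))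
    {c : ℝ} (hc : 0 < c) (hgap : ∀ i t, 0 ≤ t → ∀ j k, j ≠ k → c ≤ ‖μ i t j - μ i t k‖)
    (j : Fin m) : MSymbol 0 (fun i t => HyperbolicSystem.specProj (B i t) (μ i t) j) := by
  unfold HyperbolicSystem.specProj Lagrange.basis
  -- The projection is the product of the factors `(μ_j - μ_k)⁻¹ (B - μ_k)`, each a symbol of order
  -- zero by the gap.
  have key : ∀ s : Finset (Fin m), j ∉ s → MSymbol 0 (fun i t => Polynomial.aeval (B i t)
      (∏ k ∈ s, Lagrange.basisDivisor (μ i t j) (μ i t k))) := by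
    intro s hs
    induction s using Finset.induction_on with
    | empty => simpa using MSymbol.one
    | insert k s hk ih =>
      simp only [Finset.mem_insert, not_or] at hs
      simp only [Finset.prod_insert hk, map_mul]
      refine MSymbol.mul (d := 0) (e := 0) ?_ (ih hs.2)
      have h1 : MSymbol 0 (fun i t => (μ i t j - μ i t k)⁻¹ •
          (B i t - μ i t k • (1 : Matrix (Fin m) (Fin m) ℂ))) :=
        MSymbol.smul (d := 0) (e := 0)
          (((hμ j).sub (hμ k)).inv hc fun i t ht => hgap i t ht j k hs.1)
          (hB.sub (MSymbol.smul (d := 0) (e := 0) (hμ k) MSymbol.one))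
      refine h1.congr fun i t _ => ?_
      simp [Lagrange.basisDivisor, Algebra.algebraMap_eq_smul_one]
  exact key _ (by simp)

/-! ### The homogeneous principal part -/

section Principal

variable {n m : ℕ} {N : ℝ} {χ : ℝ → ℝ}
  {A A₁ : ℝ → EuclideanSpace ℝ (Fin n) → Matrix (Fin m) (Fin m) ℂ}
  {lam : Fin m → ℝ → EuclideanSpace ℝ (Fin n) → ℝ}

/-- The direction of a frequency. -/
noncomputable def unit (ξ : EuclideanSpace ℝ (Fin n)) : EuclideanSpace ℝ (Fin n) := ‖ξ‖⁻¹ • ξ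

theorem norm_unit {ξ : EuclideanSpace ℝ (Fin n)} (hξ : ξ ≠ 0) : ‖unit ξ‖ = 1 :=
  norm_smul_inv_norm (𝕜 := ℝ) hξ

theorem unit_ne_zero {ξ : EuclideanSpace ℝ (Fin n)} (hξ : ξ ≠ 0) : unit ξ ≠ 0 := by
  rw [← norm_ne_zero_iff, norm_unit hξ]
  exact one_ne_zero

theorem norm_smul_unit {ξ : EuclideanSpace ℝ (Fin n)} (hξ : ξ ≠ 0) : ‖ξ‖ • unit ξ = ξ :=
  smul_inv_smul₀ (norm_ne_zero_iff.2 hξ) ξ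

/-- Continuity adds the endpoint `s = 1`, needed because the hyperbolic zone contains its boundary.
-/
theorem IsCutoff.eq_zero' (hχ : IsCutoff χ) {s : ℝ} (hs : 1 ≤ s) : χ s = 0 := by
  have h : IsClosed {s | χ s = 0} := isClosed_eq hχ.smooth.continuous continuous_const
  have h2 : Ioi (1 : ℝ) ⊆ {s | χ s = 0} := fun s hs => hχ.eq_zero s hs
  have h3 := h.closure_subset_iff.2 h2
  rw [closure_Ioi] at h3
  exact h3 hs

theorem IsCutoff.cutoffHyp_eq_one (hχ : IsCutoff χ) (hN : 0 < N) {t : ℝ}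
    {ξ : EuclideanSpace ℝ (Fin n)} (h : N ≤ (1 + t) * ‖ξ‖) : cutoffHyp χ N t ξ = 1 := by
  rw [cutoffHyp, hχ.eq_zero', sub_zero]
  rw [le_div_iff₀ hN]
  linarith

/-- The lower order part of `A`. -/
noncomputable def lower (χ : ℝ → ℝ) (N : ℝ)
    (A A₁ : ℝ → EuclideanSpace ℝ (Fin n) → Matrix (Fin m) (Fin m) ℂ) (t : ℝ)
    (ξ : EuclideanSpace ℝ (Fin n)) : Matrix (Fin m) (Fin m) ℂ :=
  A t ξ - (cutoffHyp χ N t ξ : ℂ) • A₁ t ξ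

theorem lower_eq (hχ : IsCutoff χ) (hN : 0 < N) {t : ℝ} {ξ : EuclideanSpace ℝ (Fin n)}
    (h : N ≤ (1 + t) * ‖ξ‖) : lower χ N A A₁ t ξ = A t ξ - A₁ t ξ := by
  rw [lower, hχ.cutoffHyp_eq_one hN h, Complex.ofReal_one, one_smul]

/-- The spectrum scales as a set, and a strictly increasing enumeration is determined by its range.
-/
theorem AssumptionA2.lam_smul (hA2 : AssumptionA2 N χ A A₁ lam) {t : ℝ} (ht : 0 ≤ t)
    {ξ : EuclideanSpace ℝ (Fin n)} (hξ : ξ ≠ 0) {r : ℝ} (hr : 0 < r) (j : Fin m) :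
    lam j t (r • ξ) = r * lam j t ξ := by
  have hrξ : r • ξ ≠ 0 := smul_ne_zero hr.ne' hξ
  have h1 := hA2.spectrum_eq t ht _ hrξ
  have hu : IsUnit (r : ℂ) := by simpa using hr.ne'
  have h3 := spectrum.unit_smul_eq_smul (A₁ t ξ) hu.unit
  simp only [Units.smul_def, IsUnit.unit_spec] at h3
  rw [hA2.homogeneous t ht ξ hξ r hr, h3, hA2.spectrum_eq t ht ξ hξ] at h1
  have h4 : range (fun j => lam j t (r • ξ)) = range (fun j => r * lam j t ξ) := by
    ext y
    have h5 := Set.ext_iff.1 h1 (y : ℂ)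
    simp only [Set.mem_smul_set, mem_range, exists_exists_eq_and, smul_eq_mul] at h5
    norm_cast at h5
    simp only [mem_range]
    exact h5.symm
  have h5 : StrictMono fun j => r * lam j t ξ := (hA2.strictMono t ht ξ hξ).const_mul hr
  exact congrFun (((hA2.strictMono t ht _ hrξ).range_inj h5).1 h4) j

theorem AssumptionA2.lam_eq (hA2 : AssumptionA2 N χ A A₁ lam) {t : ℝ} (ht : 0 ≤ t)
    {ξ : EuclideanSpace ℝ (Fin n)} (hξ : ξ ≠ 0) (j : Fin m) :
    lam j t ξ = ‖ξ‖ * lam j t (unit ξ) := by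
  rw [← hA2.lam_smul ht (unit_ne_zero hξ) (norm_pos_iff.2 hξ), norm_smul_unit hξ]

theorem AssumptionA2.principal_eq (hA2 : AssumptionA2 N χ A A₁ lam) {t : ℝ} (ht : 0 ≤ t)
    {ξ : EuclideanSpace ℝ (Fin n)} (hξ : ξ ≠ 0) :
    A₁ t ξ = (‖ξ‖ : ℂ) • A₁ t (unit ξ) := by
  rw [← hA2.homogeneous t ht _ (unit_ne_zero hξ) _ (norm_pos_iff.2 hξ), norm_smul_unit hξ]

theorem AssumptionA2.tsymbol_root (hA2 : AssumptionA2 N χ A A₁ lam) (hN : 0 < N) (j : Fin m) :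
    TSymbol 0 (fun (x : {ξ : EuclideanSpace ℝ (Fin n) // ξ ≠ 0}) t => (lam j t (unit x) : ℂ)) := by
  refine IsSymbol.tsymbol_of_weight_le (m₁ := 1) (d := 0) hN (hA2.symbol_roots j) _
    (fun x => unit_ne_zero x.2) (r := max 1 N) fun x t ht => ?_
  rw [pow_one, weight, norm_unit x.2]
  exact max_le_max le_rfl (div_le_self hN.le (by linarith))

/-- For `r ≥ N` the point `(t, r η)` lies in the zone for every `t ≥ 0`, so the cut-off is `1`
there. The regularity of `A₁` is recovered from that of `A` and of the lower order part by means of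
this formula. -/
theorem AssumptionA2.principal_unit_eq (hA2 : AssumptionA2 N χ A A₁ lam) (hχ : IsCutoff χ)
    (hN : 0 < N) {t : ℝ} (ht : 0 ≤ t) {η : EuclideanSpace ℝ (Fin n)} (hη : ‖η‖ = 1) {r : ℝ}
    (hr : N ≤ r) :
    A₁ t η = (r : ℂ)⁻¹ • (A t (r • η) - lower χ N A A₁ t (r • η)) := by
  have hr0 : 0 < r := hN.trans_le hr
  have h0 : η ≠ 0 := by
    rw [← norm_ne_zero_iff, hη]
    exact one_ne_zero
  rw [lower_eq hχ hN, sub_sub_cancel, hA2.homogeneous t ht η h0 r hr0, inv_smul_smul₀]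
  · exact_mod_cast hr0.ne'
  · rw [norm_smul, hη, Real.norm_of_nonneg hr0.le]
    nlinarith

/-- The homogeneous principal part on the unit sphere is a symbol of order zero. -/
theorem AssumptionA2.msymbol_principal (hA2 : AssumptionA2 N χ A A₁ lam) (hχ : IsCutoff χ)
    (hA1 : AssumptionA1 N A) (hN : 0 < N) {ι : Type*} (f : ι → EuclideanSpace ℝ (Fin n))
    (hf : ∀ i, ‖f i‖ = 1) : MSymbol 0 (fun i t => A₁ t (f i)) := by
  have hnorm : ∀ i, ‖N • f i‖ = N := fun i => by
    rw [norm_smul, hf, Real.norm_of_nonneg hN.le, mul_one]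
  have h1 : MSymbol 0 (fun i t => A t (N • f i)) := fun a b =>
    IsSymbol.tsymbol_sphere (m₁ := 1) (d := 0) hN (hA1.symbol a b) _ le_rfl hnorm
  have h2 : MSymbol 1 (fun i t => lower χ N A A₁ t (N • f i)) := fun a b =>
    IsSymbol.tsymbol_sphere (m₁ := 0) (d := 1) hN (hA2.lowerOrder a b) _ le_rfl hnorm
  have h3 : MSymbol 0 (fun i t => lower χ N A A₁ t (N • f i)) := fun a b => by
    have := (h2 a b)
    exact this.of_le (Nat.zero_le 1)
  exact ((h1.sub h3).const_smul (N : ℂ)⁻¹).congr fun i t ht =>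
    (hA2.principal_unit_eq hχ hN ht (hf i) le_rfl).symm

/-- At fixed `t` the lower order part is bounded in `ξ`, so `r⁻¹ A(t, r η)` tends to `A₁(t, η)`
uniformly on the sphere as `r → ∞`. Only `A` has to be continuous. -/
theorem AssumptionA2.continuousOn_sphere (hA2 : AssumptionA2 N χ A A₁ lam) (hχ : IsCutoff χ)
    (hA1 : AssumptionA1 N A) (hN : 0 < N) {t : ℝ} (ht : 0 ≤ t) (a b : Fin m) :
    ContinuousOn (fun η => A₁ t η a b) {η | ‖η‖ = 1} := by
  obtain ⟨C, hC⟩ := (hA2.lowerOrder a b).estimate 0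
  refine continuousOn_of_uniform_approx_of_continuousOn fun u hu => ?_
  obtain ⟨ε, hε, hεu⟩ := Metric.mem_uniformity_dist.1 hu
  set D : ℝ := |C * (1 / (1 + t)) ^ (1 : ℤ)| with hD
  set r : ℝ := max N ((D + 1) / ε) with hr
  have hr0 : 0 < r := hN.trans_le (le_max_left _ _)
  have hrη : ∀ η : EuclideanSpace ℝ (Fin n), ‖η‖ = 1 → r • η ≠ 0 := fun η hη => by
    rw [← norm_ne_zero_iff, norm_smul, hη, Real.norm_of_nonneg hr0.le, mul_one]
    exact hr0.ne'
  refine ⟨fun η => (r : ℂ)⁻¹ * A t (r • η) a b, ?_, fun η hη => hεu ?_⟩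
  · exact continuousOn_const.mul ((hA1.continuous t ht a b).comp (by fun_prop)
      fun η hη => hrη η hη)
  · have hl : ‖lower χ N A A₁ t (r • η) a b‖ ≤ D := by
      have h := hC t ht _ (hrη η hη)
      simp only [iteratedDerivWithin_zero, zpow_zero, mul_one, Nat.cast_zero, add_zero] at h
      exact h.trans (le_abs_self _)
    rw [hA2.principal_unit_eq hχ hN ht hη (le_max_left N ((D + 1) / ε)), ← hr, dist_eq_norm,
      Matrix.smul_apply, Matrix.sub_apply, smul_eq_mul, mul_sub, sub_sub_cancel_left, norm_neg,
      norm_mul, norm_inv, Complex.norm_real, Real.norm_of_nonneg hr0.le, inv_mul_lt_iff₀ hr0]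
    have h1 : D + 1 ≤ r * ε := (div_le_iff₀ hε).1 (le_max_right N _)
    linarith

/-- The characteristic roots are uniformly separated on the unit sphere. -/
theorem AssumptionA2.exists_gap (hA2 : AssumptionA2 N χ A A₁ lam) (hχ : IsCutoff χ)
    (hA1 : AssumptionA1 N A) (hN : 0 < N) :
    ∃ c : ℝ, 0 < c ∧ ∀ t, 0 ≤ t → ∀ η : EuclideanSpace ℝ (Fin n), ‖η‖ = 1 →
      ∀ i j, i ≠ j → c ≤ ‖(lam i t η : ℂ) - lam j t η‖ := by
  have hev : ∀ p : Fin m × Fin m, ∃ c : ℝ, 0 < c ∧ ∃ T : ℝ, p.1 ≠ p.2 → ∀ t, T ≤ t →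
      ∀ η : EuclideanSpace ℝ (Fin n), ‖η‖ = 1 → c ≤ |lam p.1 t η - lam p.2 t η| := fun p => by
    by_cases hp : p.1 = p.2
    · exact ⟨1, one_pos, 0, fun h => absurd hp h⟩
    · obtain ⟨c, hc, h⟩ := hA2.gap _ _ hp
      obtain ⟨T, hT⟩ := Filter.eventually_atTop.1 h
      exact ⟨c, hc, T, fun _ => hT⟩
  choose c hc T hT using hev
  obtain ⟨T₀, hT₀⟩ := (Set.finite_range T).bddAbove
  obtain ⟨c₁, hc₁, hc₁'⟩ : ∃ c₁ : ℝ, 0 < c₁ ∧ ∀ p, c₁ ≤ c p := by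
    rcases isEmpty_or_nonempty (Fin m × Fin m) with h | h
    · exact ⟨1, one_pos, fun p => h.elim p⟩
    · obtain ⟨p, hp⟩ := Finite.exists_min c
      exact ⟨c p, hc p, hp⟩
  set K : Set (ℝ × EuclideanSpace ℝ (Fin n)) := Icc 0 T₀ ×ˢ {η | ‖η‖ = 1} with hK
  have hne : ∀ η : EuclideanSpace ℝ (Fin n), ‖η‖ = 1 → η ≠ 0 := fun η hη => by
    rw [← norm_ne_zero_iff, hη]
    exact one_ne_zero
  have hKc : IsCompact K := by
    refine isCompact_Icc.prod ?_
    have : {η : EuclideanSpace ℝ (Fin n) | ‖η‖ = 1} = Metric.sphere 0 1 := by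
      ext η
      simp
    rw [this]
    exact isCompact_sphere 0 1
  have hsym := hA2.msymbol_principal hχ hA1 hN
    (fun x : {η : EuclideanSpace ℝ (Fin n) // ‖η‖ = 1} => x.1) fun x => x.2
  obtain ⟨D, hD0, hD⟩ := hsym.deriv.bound'
  have hcont : ∀ a b, ContinuousOn (fun p : ℝ × EuclideanSpace ℝ (Fin n) => A₁ p.1 p.2 a b) K := by
    intro a b
    -- Joint continuity: continuous in `η` for each `t`, and Lipschitz in `t` with a constant
    -- independent of `η`, by the bound on the first derivative.
    refine continuousOn_prod_of_continuousOn_lipschitzOnWith _ D.toNNReal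
      (fun t ht => hA2.continuousOn_sphere hχ hA1 hN ht.1 a b) fun η hη => ?_
    have h := (convex_Ici (0 : ℝ)).lipschitzOnWith_of_nnnorm_hasDerivWithin_le
      (C := D.toNNReal) (fun t ht => hsym.hasDeriv ⟨η, hη⟩ ht a b) fun t ht => by
        rw [← NNReal.coe_le_coe, Real.coe_toNNReal _ hD0]
        exact hD ⟨η, hη⟩ t ht a b
    exact h.mono Icc_subset_Ici_self
  choose Λ hΛ using fun j => (IsSymbol.tsymbol_of_weight_le (m₁ := 1) (d := 0) hN
    (hA2.symbol_roots j) (fun x : {η : EuclideanSpace ℝ (Fin n) // ‖η‖ = 1} => x.1)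
    (fun x => hne _ x.2) (r := max 1 N) fun x t ht => by
      rw [pow_one, weight, x.2]
      exact max_le_max le_rfl (div_le_self hN.le (by linarith))).decays
  obtain ⟨Λ₀, hΛ₀⟩ := (Set.finite_range Λ).bddAbove
  obtain ⟨c₂, hc₂, hc₂'⟩ := exists_gap_of_isCompact hKc hcont
    (μ := fun p j => (lam j p.1 p.2 : ℂ))
    (fun p hp => Complex.ofReal_injective.comp (hA2.strictMono p.1 hp.1.1 p.2 (hne _ hp.2)).injective)
    (fun p hp => hA2.spectrum_eq p.1 hp.1.1 p.2 (hne _ hp.2)) (Λ := Λ₀)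
    (fun p hp j => by
      have h := hΛ j ⟨p.2, hp.2⟩ p.1 hp.1.1
      simp only [pow_zero, mul_one] at h
      exact h.trans (hΛ₀ (mem_range_self j)))
  refine ⟨min c₁ c₂, lt_min hc₁ hc₂, fun t ht η hη i j hij => ?_⟩
  rcases le_total t T₀ with h | h
  · exact (min_le_right _ _).trans (hc₂' (t, η) ⟨⟨ht, h⟩, hη⟩ i j hij)
  · refine (min_le_left _ _).trans ((hc₁' (i, j)).trans ?_)
    have := hT (i, j) hij t ((hT₀ (mem_range_self _)).trans h) η hη
    rwa [← Complex.ofReal_sub, Complex.norm_real]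

theorem AssumptionA2.exists_isDiagonaliser (hA2 : AssumptionA2 N χ A A₁ lam) (hχ : IsCutoff χ)
    (hA1 : AssumptionA1 N A) (hN : 0 < N) : ∃ M, IsDiagonaliser N A₁ lam M := by
  obtain ⟨c, hc, hgap⟩ := hA2.exists_gap hχ hA1 hN
  set B : {ξ : EuclideanSpace ℝ (Fin n) // ξ ≠ 0} → ℝ → Matrix (Fin m) (Fin m) ℂ :=
    fun x t => A₁ t (unit x) with hBdef
  set μ : {ξ : EuclideanSpace ℝ (Fin n) // ξ ≠ 0} → ℝ → Fin m → ℂ :=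
    fun x t j => (lam j t (unit x) : ℂ) with hμdef
  have hB : MSymbol 0 B := hA2.msymbol_principal hχ hA1 hN _ fun x => norm_unit x.2
  have hinj : ∀ x t, 0 ≤ t → Function.Injective (μ x t) := fun x t ht =>
    Complex.ofReal_injective.comp (hA2.strictMono t ht _ (unit_ne_zero x.2)).injective
  have hsp : ∀ x t, 0 ≤ t → spectrum ℂ (B x t) = range (μ x t) := fun x t ht =>
    hA2.spectrum_eq t ht _ (unit_ne_zero x.2)
  have hP : ∀ j, MSymbol 0 (fun x t => specProj (B x t) (μ x t) j) := fun j =>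
    hB.specProj (fun j => hA2.tsymbol_root hN j) hc
      (fun x t ht j k hjk => hgap t ht _ (norm_unit x.2) j k hjk) j
  choose v hv hv' using fun j => exists_unit_section (hP j)
    (fun x t ht => specProj_mul_self (hinj x t ht) (hsp x t ht) j)
    (fun x => specProj_ne_zero (hinj x 0 le_rfl) (hsp x 0 le_rfl) j)
  set M₀ : {ξ : EuclideanSpace ℝ (Fin n) // ξ ≠ 0} → ℝ → Matrix (Fin m) (Fin m) ℂ :=
    fun x t => Matrix.of fun a j => v j x t a with hM₀
  -- The rows `v_j* P_j` form the inverse of the matrix with columns `v_k`, because `P_j v_k` is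
  -- `v_j` or `0` and `v_j` has length one. This makes `M⁻¹` visibly a symbol, with no determinant
  -- to bound below.
  set L₀ : {ξ : EuclideanSpace ℝ (Fin n) // ξ ≠ 0} → ℝ → Matrix (Fin m) (Fin m) ℂ :=
    fun x t => Matrix.of fun j b => ∑ a, star (v j x t a) * specProj (B x t) (μ x t) j a b with hL₀
  have hLM : ∀ x t, 0 ≤ t → L₀ x t * M₀ x t = 1 := fun x t ht => by
    ext j k
    have h1 : (L₀ x t * M₀ x t) j k
        = star (v j x t) ⬝ᵥ (specProj (B x t) (μ x t) j *ᵥ v k x t) := by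
      rw [Matrix.dotProduct_mulVec]
      rfl
    rw [h1]
    by_cases hjk : j = k
    · subst hjk
      rw [(hv' j x t ht).1, (hv' j x t ht).2, Matrix.one_apply_eq]
    · rw [← (hv' k x t ht).1, Matrix.mulVec_mulVec,
        specProj_mul_of_ne (hinj x t ht) (hsp x t ht) hjk, Matrix.zero_mulVec, dotProduct_zero,
        Matrix.one_apply_ne hjk]
  have hBM : ∀ x t, 0 ≤ t → B x t * M₀ x t = M₀ x t * Matrix.diagonal (μ x t) := fun x t ht => by
    ext a j
    have h1 : (B x t * M₀ x t) a j = (B x t *ᵥ v j x t) a := rfl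
    rw [h1, ← (hv' j x t ht).1, Matrix.mulVec_mulVec, mul_specProj (hinj x t ht) (hsp x t ht),
      Matrix.smul_mulVec, (hv' j x t ht).1, Matrix.mul_diagonal, mul_comm]
    rfl
  have hinv : ∀ x t, 0 ≤ t → (M₀ x t)⁻¹ = L₀ x t := fun x t ht =>
    Matrix.inv_eq_left_inv (hLM x t ht)
  classical
  set M : ℝ → EuclideanSpace ℝ (Fin n) → Matrix (Fin m) (Fin m) ℂ := fun t ξ =>
    if h : ξ ≠ 0 then M₀ ⟨ξ, h⟩ t else 1 with hM
  have hMM : ∀ (x : {ξ : EuclideanSpace ℝ (Fin n) // ξ ≠ 0}) t, M t x = M₀ x t := fun x t => by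
    simp only [hM]
    rw [dif_pos x.2]
  refine ⟨M, fun t ht ξ hξ => ?_, fun a j => TSymbol.isSymbol ?_, fun j b => TSymbol.isSymbol ?_,
    fun t ht ξ hξ => ?_⟩
  · rw [hMM ⟨ξ, hξ⟩, ← Matrix.isUnit_iff_isUnit_det]
    exact .of_mul_eq_one_right _ (hLM ⟨ξ, hξ⟩ t ht)
  · exact (hv j a).congr fun x t _ => by rw [hMM]; rfl
  · have hL : TSymbol 0 (fun x t => ∑ a, star (v j x t a) * specProj (B x t) (μ x t) j a b) :=
      TSymbol.sum _ fun a _ => by simpa using (hv j a).conj.mul (hP j a b)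
    refine hL.congr fun x t ht => ?_
    change L₀ x t j b = (M t x)⁻¹ j b
    rw [hMM, hinv x t ht]
  · rw [hMM ⟨ξ, hξ⟩, hA2.principal_eq ht hξ, smul_mul_assoc]
    refine (congrArg _ (hBM ⟨ξ, hξ⟩ t ht)).trans ?_
    rw [← mul_smul_comm, ← Matrix.diagonal_smul]
    congr 2
    ext j
    rw [hA2.lam_eq ht hξ j]
    simp [hμdef]

end Principal

/-! ### Estimates for the diagonalised system at a fixed frequency -/

section Reduced

variable {m : ℕ}

/-- This is where real roots matter: `i c |z|²` has no real part, so the principal part, of size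
`|ξ|`, leaves every energy identity. -/
theorem re_star_mul_I_mul (z y : ℂ) (c : ℝ) :
    (star z * (Complex.I * (c * z + y))).re = (star z * (Complex.I * y)).re := by
  simp
  ring

/-- The system `D_t W = (diag ℓ + R) W` on `[a, ∞)` at a frequency of norm `r`, together with the
system `D_t z = (diag ℓ + diag R) z + r⁻¹ B W` solved by `z = (1 + r⁻¹ Q) W`. -/
structure ReducedSystem (a r CR CQ CB : ℝ) (ℓ : Fin m → ℝ → ℝ)
    (R Q B : ℝ → Matrix (Fin m) (Fin m) ℂ) (W z : ℝ → Fin m → ℂ) : Prop where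
  start_nonneg : 0 ≤ a
  norm_pos : 0 < r
  bound_R : ∀ t, a ≤ t → ∀ j k, ‖R t j k‖ * (1 + t) ≤ CR
  bound_Q : ∀ t, a ≤ t → ∀ j k, ‖Q t j k‖ * (1 + t) ≤ CQ
  bound_B : ∀ t, a ≤ t → ∀ j k, ‖B t j k‖ * (1 + t) ^ 2 ≤ CB
  deriv_W : ∀ t, a ≤ t → ∀ j, HasDerivWithinAt (fun τ => W τ j)
    (Complex.I * (ℓ j t * W t j + (R t *ᵥ W t) j)) (Ici a) t
  eq_z : ∀ t, z t = W t + (r⁻¹ : ℂ) • (Q t *ᵥ W t)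
  deriv_z : ∀ t, a ≤ t → ∀ j, HasDerivWithinAt (fun τ => z τ j)
    (Complex.I * (ℓ j t * z t j + (R t j j * z t j + (r⁻¹ : ℂ) * (B t *ᵥ W t) j))) (Ici a) t

namespace ReducedSystem

variable {a r CR CQ CB : ℝ} {ℓ : Fin m → ℝ → ℝ} {R Q B : ℝ → Matrix (Fin m) (Fin m) ℂ}
  {W z : ℝ → Fin m → ℂ}

theorem mono (h : ReducedSystem a r CR CQ CB ℓ R Q B W z) {b : ℝ} (hab : a ≤ b) :
    ReducedSystem b r CR CQ CB ℓ R Q B W z where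
  start_nonneg := h.start_nonneg.trans hab
  norm_pos := h.norm_pos
  bound_R t ht := h.bound_R t (hab.trans ht)
  bound_Q t ht := h.bound_Q t (hab.trans ht)
  bound_B t ht := h.bound_B t (hab.trans ht)
  deriv_W t ht j := (h.deriv_W t (hab.trans ht) j).mono (Ici_subset_Ici.2 hab)
  eq_z := h.eq_z
  deriv_z t ht j := (h.deriv_z t (hab.trans ht) j).mono (Ici_subset_Ici.2 hab)

theorem hasDerivAt_log {t : ℝ} (ht : 0 ≤ t) (c : ℝ) :
    HasDerivAt (fun t => c * Real.log (1 + t)) (c / (1 + t)) t := by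
  refine ((((hasDerivAt_id t).const_add 1).log (by positivity)).const_mul c).congr_deriv ?_
  simp [div_eq_mul_inv]

theorem hasDerivAt_neg_div {t : ℝ} (ht : 0 ≤ t) (c : ℝ) :
    HasDerivAt (fun t => -(c / (1 + t))) (c / (1 + t) ^ 2) t := by
  have h := (((hasDerivAt_id t).const_add 1).fun_inv (by positivity)).const_mul (-c)
  refine (h.congr_deriv ?_).congr_of_eventuallyEq (.of_forall fun s => ?_)
  · simp
    ring
  · simp
    ring

/-- Both values of this primitive of `c r⁻¹ (1+t)⁻²` lie in `[-c/N', 0]` once `(1+t) r ≥ N'`. This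
is the integrability of the remainder over the zone, uniform in the frequency. -/
theorem abs_div_sub_div_le {c N' s t : ℝ} (hc : 0 ≤ c) (hN' : 0 < N') (hr : 0 < r) (ha : 0 ≤ a)
    (hz : N' ≤ (1 + a) * r) (hs : a ≤ s) (ht : a ≤ t) :
    |-(c / r / (1 + t)) - -(c / r / (1 + s))| ≤ c / N' := by
  have key : ∀ u, a ≤ u → 0 ≤ c / r / (1 + u) ∧ c / r / (1 + u) ≤ c / N' := fun u hu => by
    have hu0 : 0 < 1 + u := by linarith
    refine ⟨by positivity, ?_⟩
    rw [div_div]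
    refine div_le_div_of_nonneg_left hc hN' (hz.trans ?_)
    rw [mul_comm]
    gcongr
  rw [abs_le]
  have h1 := key s hs
  have h2 := key t ht
  exact ⟨by linarith, by linarith⟩

/-- Rough energy estimate, with logarithmic loss. -/
theorem normSqSum_W_le (h : ReducedSystem a r CR CQ CB ℓ R Q B W z) {s t : ℝ} (hs : a ≤ s)
    (ht : a ≤ t) :
    normSqSum (W t) ≤ Real.exp |2 * CR * m * Real.log (1 + t) - 2 * CR * m * Real.log (1 + s)| *
      normSqSum (W s) := by
  have ha := h.start_nonneg
  refine le_exp_mul_of_abs_deriv_le (φ := fun t => 2 * CR * m * Real.log (1 + t))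
    (fun t ht => hasDerivWithinAt_normSqSum (h.deriv_W t ht))
    (fun t ht => (hasDerivAt_log (ha.trans ht) (2 * CR * m)).hasDerivWithinAt)
    (fun t _ => normSqSum_nonneg _) (fun t ht => ?_) hs ht
  have ht0 : 0 < 1 + t := by linarith
  have hR : ∀ j k, ‖R t j k‖ ≤ CR / (1 + t) := fun j k => (le_div_iff₀ ht0).2 (h.bound_R t ht j k)
  simp only [re_star_mul_I_mul]
  refine (abs_sum_two_mul_re_le (y := fun j => Complex.I * (R t *ᵥ W t) j)
    (κ := CR / (1 + t)) fun j => ?_).trans ?_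
  · simpa using norm_mulVec_apply_le hR (W t) j
  · rcases isEmpty_or_nonempty (Fin m) with hm | ⟨⟨j⟩⟩
    · simp [normSqSum]
    have hCR : 0 ≤ CR := le_trans (by positivity) (h.bound_R t ht j j)
    calc 2 * (CR / (1 + t)) * (∑ k, ‖W t k‖) ^ 2
        ≤ 2 * (CR / (1 + t)) * (m * normSqSum (W t)) := by gcongr; exact sq_sum_norm_le _
      _ = _ := by ring

/-- The entries of `r⁻¹ Q` are at most `CQ / N'`, so `2 m CQ ≤ N'` gives `|z - W| ≤ |W| / 2`. -/
theorem normSqSum_compare (h : ReducedSystem a r CR CQ CB ℓ R Q B W z) {N' : ℝ} (hN' : 0 < N')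
    (hz : N' ≤ (1 + a) * r) (hQ : 2 * m * CQ ≤ N') {t : ℝ} (ht : a ≤ t) :
    normSqSum (W t) ≤ 4 * normSqSum (z t) ∧ normSqSum (z t) ≤ 4 * normSqSum (W t) := by
  have ha := h.start_nonneg
  have hr := h.norm_pos
  have ht0 : 0 < 1 + t := by linarith
  have hQt : ∀ j k, ‖((r⁻¹ : ℂ) • Q t) j k‖ ≤ CQ / N' := fun j k => by
    have h1 := h.bound_Q t ht j k
    have hCQ : 0 ≤ CQ := le_trans (by positivity) h1
    rw [Matrix.smul_apply, smul_eq_mul, norm_mul, norm_inv, Complex.norm_real,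
      Real.norm_of_nonneg hr.le, inv_mul_le_iff₀ hr]
    rw [← le_div_iff₀ ht0] at h1
    refine h1.trans ?_
    rw [div_le_iff₀ ht0, mul_comm r, mul_assoc, div_mul_eq_mul_div, le_div_iff₀ hN']
    gcongr
    refine hz.trans ?_
    rw [mul_comm]
    gcongr
  have hd : normSqSum (fun j => z t j - W t j) ≤ 1 / 4 * normSqSum (W t) := by
    have e : (fun j => z t j - W t j) = ((r⁻¹ : ℂ) • Q t) *ᵥ W t := by
      ext j
      simp [h.eq_z, Matrix.smul_mulVec]
    rw [e]
    refine (normSqSum_mulVec_le hQt _).trans ?_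
    gcongr
    · exact normSqSum_nonneg _
    · rcases isEmpty_or_nonempty (Fin m) with hm | ⟨⟨j⟩⟩
      · have : m = 0 := by_contra fun h => hm.elim ⟨0, Nat.pos_of_ne_zero h⟩
        subst this
        norm_num
      have hCQ : 0 ≤ CQ := le_trans (by positivity) (h.bound_Q t ht j j)
      have h2 : m * (CQ / N') ≤ 1 / 2 := by
        rw [← mul_div_assoc, div_le_iff₀ hN']
        linarith
      calc (m * (CQ / N')) ^ 2 ≤ (1 / 2) ^ 2 := by gcongr
        _ = 1 / 4 := by norm_num
  have key : ∀ x y : ℂ, ‖x‖ ^ 2 ≤ 2 * ‖y‖ ^ 2 + 2 * ‖x - y‖ ^ 2 := fun x y => by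
    have h1 : ‖x‖ ≤ ‖y‖ + ‖x - y‖ := by
      simpa using norm_add_le y (x - y)
    nlinarith [norm_nonneg x, norm_nonneg y, norm_nonneg (x - y), sq_nonneg (‖y‖ - ‖x - y‖)]
  have sumkey : ∀ x y : Fin m → ℂ,
      normSqSum x ≤ 2 * normSqSum y + 2 * normSqSum fun j => x j - y j := fun x y => by
    simp only [normSqSum, Finset.mul_sum, ← Finset.sum_add_distrib]
    exact Finset.sum_le_sum fun j _ => key _ _
  have h1 := sumkey (z t) (W t)
  have h2 := sumkey (W t) (z t)
  have h3 : normSqSum (fun j => W t j - z t j) = normSqSum fun j => z t j - W t j := by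
    simp only [normSqSum, norm_sub_rev]
  have h4 := normSqSum_nonneg (W t)
  constructor <;> linarith

/-- The weighted modulus of one component satisfies an equation without principal part. -/
theorem hasDerivWithinAt_weighted (h : ReducedSystem a r CR CQ CB ℓ R Q B W z) {j : Fin m}
    {g : ℝ → ℝ} {t : ℝ} (ht : a ≤ t) (hg : HasDerivWithinAt g (R t j j).im (Ici a) t) :
    HasDerivWithinAt (fun τ => ‖z τ j‖ ^ 2 * Real.exp (2 * g τ))
      (2 * (star (z t j) * (Complex.I * ((r⁻¹ : ℂ) * (B t *ᵥ W t) j))).re * Real.exp (2 * g t))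
      (Ici a) t := by
  refine ((hasDerivWithinAt_norm_sq (h.deriv_z t ht j)).mul (hg.const_mul 2).exp).congr_deriv ?_
  rw [re_star_mul_I_mul]
  have e : (star (z t j) * (Complex.I * (R t j j * z t j + (r⁻¹ : ℂ) * (B t *ᵥ W t) j))).re
      = (star (z t j) * (Complex.I * ((r⁻¹ : ℂ) * (B t *ᵥ W t) j))).re
        - ‖z t j‖ ^ 2 * (R t j j).im := by
    rw [mul_add, mul_add, Complex.add_re]
    have e2 : star (z t j) * (Complex.I * (R t j j * z t j))
        = ((‖z t j‖ ^ 2 : ℝ) : ℂ) * (Complex.I * R t j j) := by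
      push_cast
      rw [← Complex.conj_mul', Complex.star_def]
      ring
    rw [e2, Complex.re_ofReal_mul, Complex.I_mul_re]
    ring
  rw [e]
  ring

theorem norm_remainder_le (h : ReducedSystem a r CR CQ CB ℓ R Q B W z) {t : ℝ} (ht : a ≤ t)
    (j : Fin m) :
    |2 * (star (z t j) * (Complex.I * ((r⁻¹ : ℂ) * (B t *ᵥ W t) j))).re|
      ≤ 2 * ‖z t j‖ * (∑ k, ‖W t k‖) * (CB / r / (1 + t) ^ 2) := by
  have hr := h.norm_pos
  have ht0 : 0 < 1 + t := by linarith [h.start_nonneg]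
  have hB : ∀ j k, ‖B t j k‖ ≤ CB / (1 + t) ^ 2 := fun j k =>
    (le_div_iff₀ (by positivity)).2 (h.bound_B t ht j k)
  have h1 := Complex.abs_re_le_norm (star (z t j) * (Complex.I * ((r⁻¹ : ℂ) * (B t *ᵥ W t) j)))
  rw [norm_mul, norm_star, norm_mul, norm_mul, Complex.norm_I, one_mul, norm_inv,
    Complex.norm_real, Real.norm_of_nonneg hr.le] at h1
  rw [abs_mul, abs_two]
  calc _ ≤ 2 * (‖z t j‖ * (r⁻¹ * ‖(B t *ᵥ W t) j‖)) := by gcongr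
    _ ≤ 2 * (‖z t j‖ * (r⁻¹ * (CB / (1 + t) ^ 2 * ∑ k, ‖W t k‖))) := by
        gcongr
        exact norm_mulVec_apply_le hB _ _
    _ = _ := by ring

/-- If the integrals of `Im R_jj` are bounded, the energy is uniformly conserved. -/
theorem normSqSum_z_le (h : ReducedSystem a r CR CQ CB ℓ R Q B W z) {N' : ℝ} (hN' : 0 < N')
    (hz : N' ≤ (1 + a) * r) (hQ : 2 * m * CQ ≤ N') (hCB : 0 ≤ CB) {G : Fin m → ℝ → ℝ}
    (hG : ∀ j t, a ≤ t → HasDerivWithinAt (G j) (R t j j).im (Ici a) t) {C : ℝ}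
    (hGC : ∀ j s t, a ≤ s → a ≤ t → |G j t - G j s| ≤ C) {s t : ℝ} (hs : a ≤ s) (ht : a ≤ t) :
    normSqSum (z t) ≤ Real.exp (4 * C + 6 * m * CB * Real.exp (4 * C) / N') * normSqSum (z s) := by
  have ha := h.start_nonneg
  have hr := h.norm_pos
  set f : ℝ → ℝ := fun t => ∑ j, ‖z t j‖ ^ 2 * Real.exp (2 * (G j t - G j a)) with hf
  have hg : ∀ j t, a ≤ t → HasDerivWithinAt (fun t => G j t - G j a) (R t j j).im (Ici a) t :=
    fun j t ht => (hG j t ht).sub_const _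
  have hlow : ∀ t, a ≤ t → normSqSum (z t) ≤ Real.exp (2 * C) * f t := fun t ht => by
    rw [hf, Finset.mul_sum]
    refine Finset.sum_le_sum fun j _ => ?_
    have h1 : 1 ≤ Real.exp (2 * C) * Real.exp (2 * (G j t - G j a)) := by
      rw [← Real.exp_add]
      refine Real.one_le_exp ?_
      linarith [(abs_le.1 (hGC j a t le_rfl ht)).1]
    nlinarith [sq_nonneg ‖z t j‖]
  have hup : ∀ j t, a ≤ t → Real.exp (2 * (G j t - G j a)) ≤ Real.exp (2 * C) := fun j t ht =>
    Real.exp_le_exp.2 (by linarith [(abs_le.1 (hGC j a t le_rfl ht)).2])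
  have hup' : ∀ t, a ≤ t → f t ≤ Real.exp (2 * C) * normSqSum (z t) := fun t ht => by
    rw [hf, normSqSum, Finset.mul_sum]
    refine Finset.sum_le_sum fun j _ => ?_
    rw [mul_comm]
    exact mul_le_mul_of_nonneg_right (hup j t ht) (by positivity)
  have hf0 : ∀ t, 0 ≤ f t := fun t => Finset.sum_nonneg fun j _ => by positivity
  -- The product `2 (∑|z|)(∑|W|)` is at most `(m + 4m)|z|²`. One factor `exp(2C)` bounds the
  -- weights, another passes from `|z|²` back to `f`.
  set κ : ℝ := 6 * m * CB * Real.exp (4 * C) with hκ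
  have hmain : f t ≤ Real.exp |-(κ / r / (1 + t)) - -(κ / r / (1 + s))| * f s := by
    refine le_exp_mul_of_abs_deriv_le (φ := fun t => -(κ / r / (1 + t)))
      (fun t ht => HasDerivWithinAt.fun_sum fun j _ =>
        h.hasDerivWithinAt_weighted ht (hg j t ht))
      (fun t ht => (hasDerivAt_neg_div (ha.trans ht) (κ / r)).hasDerivWithinAt)
      (fun t _ => hf0 t) (fun t ht => ?_) hs ht
    have ht0 : 0 < 1 + t := by linarith
    refine (Finset.abs_sum_le_sum_abs _ _).trans ?_
    have h1 : ∀ j ∈ Finset.univ, |2 * (star (z t j) *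
        (Complex.I * ((r⁻¹ : ℂ) * (B t *ᵥ W t) j))).re * Real.exp (2 * (G j t - G j a))|
        ≤ ‖z t j‖ * (2 * (∑ k, ‖W t k‖) * (CB / r / (1 + t) ^ 2) * Real.exp (2 * C)) :=
      fun j _ => by
        rw [abs_mul, Real.abs_exp]
        refine (mul_le_mul (h.norm_remainder_le ht j) (hup j t ht) (Real.exp_nonneg _)
          (by positivity)).trans (le_of_eq (by ring))
    refine (Finset.sum_le_sum h1).trans ?_
    rw [← Finset.sum_mul]
    have h2 := sq_sum_norm_le (z t)
    have h3 := sq_sum_norm_le (W t)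
    have h4 := (h.normSqSum_compare hN' hz hQ ht).1
    have h5 : (∑ j, ‖z t j‖) * (2 * ∑ k, ‖W t k‖) ≤ 6 * m * normSqSum (z t) := by
      have h6 := mul_le_mul_of_nonneg_left h4 (Nat.cast_nonneg (α := ℝ) m)
      have h7 := mul_nonneg (Nat.cast_nonneg (α := ℝ) m) (normSqSum_nonneg (z t))
      nlinarith [sq_nonneg ((∑ j, ‖z t j‖) - ∑ k, ‖W t k‖)]
    calc _ = ((∑ j, ‖z t j‖) * (2 * ∑ k, ‖W t k‖)) *
          (CB / r / (1 + t) ^ 2 * Real.exp (2 * C)) := by ring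
      _ ≤ (6 * m * (Real.exp (2 * C) * f t)) * (CB / r / (1 + t) ^ 2 * Real.exp (2 * C)) := by
          refine mul_le_mul_of_nonneg_right (h5.trans ?_) (by positivity)
          exact mul_le_mul_of_nonneg_left (hlow t ht) (by positivity)
      _ = _ := by
          rw [hκ, show 4 * C = 2 * C + 2 * C by ring, Real.exp_add]
          ring
  have hκ0 : 0 ≤ κ := by positivity
  have hexp : |-(κ / r / (1 + t)) - -(κ / r / (1 + s))| ≤ κ / N' :=
    abs_div_sub_div_le hκ0 hN' hr ha hz hs ht
  calc normSqSum (z t) ≤ Real.exp (2 * C) * f t := hlow t ht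
    _ ≤ Real.exp (2 * C) * (Real.exp (κ / N') * f s) := by
        gcongr
        exact hmain.trans (mul_le_mul_of_nonneg_right (Real.exp_le_exp.2 hexp) (hf0 s))
    _ ≤ Real.exp (2 * C) * (Real.exp (κ / N') * (Real.exp (2 * C) * normSqSum (z s))) := by
        gcongr
        exact hup' s hs
    _ = _ := by
        rw [Real.exp_add, show 4 * C = 2 * C + 2 * C by ring, Real.exp_add]
        ring

end ReducedSystem

/-- If all solutions starting in the `j`-th unit vector are bounded, then the integrals of
`Im R_jj` are bounded. -/
theorem sub_le_of_bounded_solutions {a r CR CQ CB : ℝ} {ℓ : Fin m → ℝ → ℝ}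
    {R Q B : ℝ → Matrix (Fin m) (Fin m) ℂ} {N' D : ℝ} (hN' : 0 < N') (hr : 0 < r) (ha : 0 ≤ a)
    (hz : N' ≤ (1 + a) * r)
    (hQ : 2 * m * CQ ≤ N') (hCB : 0 ≤ CB) (hD : 0 < D) (hND : 2 * ((4 + m) * D * CB) ≤ N')
    {j : Fin m} (hQ0 : ∀ t, Q t j j = 0) {W z : ℝ → ℝ → Fin m → ℂ}
    (hsys : ∀ s, a ≤ s → ReducedSystem a r CR CQ CB ℓ R Q B (W s) (z s))
    (hWs : ∀ s, a ≤ s → W s s = Pi.single j 1)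
    (hWb : ∀ s t, a ≤ s → a ≤ t → normSqSum (W s t) ≤ D) {g : ℝ → ℝ}
    (hg : ∀ t, a ≤ t → HasDerivWithinAt g (R t j j).im (Ici a) t) {s t : ℝ} (hs : a ≤ s)
    (ht : a ≤ t) : g s - g t ≤ Real.log (8 * D) / 2 := by
  set T : ℝ := max s t with hT
  have hsT : s ∈ Icc a T := ⟨hs, le_max_left _ _⟩
  have htT : t ∈ Icc a T := ⟨ht, le_max_right _ _⟩
  have hsub : Icc a T ⊆ Ici a := Icc_subset_Ici_self
  have hgc : ContinuousOn g (Icc a T) := fun t ht => ((hg t ht.1).mono hsub).continuousWithinAt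
  -- The solution is started at the maximum `σ` of `g` and followed to `t`, which may lie on either
  -- side of `σ`. The weight along the way never exceeds its initial value.
  obtain ⟨σ, hσ, hmax⟩ := isCompact_Icc.exists_isMaxOn ⟨s, hsT⟩ hgc
  have hmax' : ∀ u ∈ Icc a T, g u ≤ g σ := isMaxOn_iff.1 hmax
  have h := hsys σ hσ.1
  have hzσ : z σ σ j = 1 := by
    rw [h.eq_z, hWs σ hσ.1]
    simp [hQ0]
  have hzb : ∀ u, a ≤ u → ‖z σ u j‖ ^ 2 ≤ 4 * D := fun u hu =>
    (norm_sq_le_normSqSum _ j).trans (((h.normSqSum_compare hN' hz hQ hu).2).trans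
      (by linarith [hWb σ u hσ.1 hu]))
  set c : ℝ := (4 + m) * D * CB * Real.exp (2 * g σ) with hc
  have hc0 : 0 ≤ c := by positivity
  have hmain := abs_sub_le_of_abs_deriv_le (convex_Icc a T)
    (f := fun u => ‖z σ u j‖ ^ 2 * Real.exp (2 * g u)) (φ := fun u => -(c / r / (1 + u)))
    (fun u hu => (h.hasDerivWithinAt_weighted hu.1 (hg u hu.1)).mono hsub)
    (fun u hu => (ReducedSystem.hasDerivAt_neg_div (ha.trans hu.1) (c / r)).hasDerivWithinAt)
    (fun u hu => by
      have hu0 : 0 < 1 + u := by linarith [hu.1]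
      rw [abs_mul, Real.abs_exp]
      have h1 : 2 * ‖z σ u j‖ * (∑ k, ‖W σ u k‖) ≤ (4 + m) * D := by
        have h2 := sq_sum_norm_le (W σ u)
        have h3 := mul_le_mul_of_nonneg_left (hWb σ u hσ.1 hu.1) (Nat.cast_nonneg (α := ℝ) m)
        have h4 := hzb u hu.1
        nlinarith [sq_nonneg (‖z σ u j‖ - ∑ k, ‖W σ u k‖)]
      calc _ ≤ (2 * ‖z σ u j‖ * (∑ k, ‖W σ u k‖) * (CB / r / (1 + u) ^ 2)) *
            Real.exp (2 * g u) := by gcongr; exact h.norm_remainder_le hu.1 j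
        _ ≤ ((4 + m) * D * (CB / r / (1 + u) ^ 2)) * Real.exp (2 * g σ) := by
            gcongr
            exact hmax' u hu
        _ = _ := by rw [hc]; ring) hσ htT
  have hexp := ReducedSystem.abs_div_sub_div_le hc0 hN' hr ha hz hσ.1 ht
  have h1 := (abs_le.1 (hmain.trans hexp)).1
  simp only [hzσ, norm_one, one_pow, one_mul] at h1
  -- By `hND` at least half of the initial value `exp(2 g σ)` survives at `t`. Together with `|z_j|²
  -- ≤ 4 D` this produces the constant `8 D`.
  have h2 : c / N' ≤ 1 / 2 * Real.exp (2 * g σ) := by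
    rw [div_le_iff₀ hN', hc]
    nlinarith [Real.exp_pos (2 * g σ)]
  have h3 : ‖z σ t j‖ ^ 2 * Real.exp (2 * g t) ≤ 4 * D * Real.exp (2 * g t) := by
    gcongr
    exact hzb t ht
  have h4 : Real.exp (2 * g σ) ≤ Real.exp (Real.log (8 * D) + 2 * g t) := by
    rw [Real.exp_add, Real.exp_log (by positivity)]
    linarith
  have h5 := Real.exp_le_exp.1 h4
  linarith [hmax' s hsT]

end Reduced

/-! ### Diagonalisation modulo integrable remainders -/

section Diagonalisation

variable {n m : ℕ} {N : ℝ} {χ : ℝ → ℝ}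
  {A A₁ M : ℝ → EuclideanSpace ℝ (Fin n) → Matrix (Fin m) (Fin m) ℂ}
  {lam : Fin m → ℝ → EuclideanSpace ℝ (Fin n) → ℝ}

/-- The lower order terms `M⁻¹ L M - M⁻¹ D_t M` of the diagonalised system. -/
noncomputable def coupling (χ : ℝ → ℝ) (N : ℝ)
    (A A₁ M : ℝ → EuclideanSpace ℝ (Fin n) → Matrix (Fin m) (Fin m) ℂ)
    (ξ : EuclideanSpace ℝ (Fin n)) (t : ℝ) : Matrix (Fin m) (Fin m) ℂ :=
  (M t ξ)⁻¹ * lower χ N A A₁ t ξ * M t ξ - (M t ξ)⁻¹ * Dt M t ξ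

/-- The solution `Q` of `[Q, diag λ] = diag R - R`, normalised by `|ξ|`. -/
noncomputable def corrector (lam : Fin m → ℝ → EuclideanSpace ℝ (Fin n) → ℝ)
    (R : EuclideanSpace ℝ (Fin n) → ℝ → Matrix (Fin m) (Fin m) ℂ)
    (ξ : EuclideanSpace ℝ (Fin n)) (t : ℝ) : Matrix (Fin m) (Fin m) ℂ :=
  Matrix.of fun j k => if j = k then 0 else
    R ξ t j k * ((lam j t (unit ξ) : ℂ) - lam k t (unit ξ))⁻¹

/-- The remainder after one step of diagonalisation. -/
noncomputable def remainder (lam : Fin m → ℝ → EuclideanSpace ℝ (Fin n) → ℝ)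
    (R : EuclideanSpace ℝ (Fin n) → ℝ → Matrix (Fin m) (Fin m) ℂ)
    (ξ : EuclideanSpace ℝ (Fin n)) (t : ℝ) : Matrix (Fin m) (Fin m) ℂ :=
  corrector lam R ξ t * R ξ t - Complex.I • matDeriv (corrector lam R ξ) t
    - Matrix.diagonal (R ξ t).diag * corrector lam R ξ t

theorem Dt_eq (M : ℝ → EuclideanSpace ℝ (Fin n) → Matrix (Fin m) (Fin m) ℂ) (t : ℝ)
    (ξ : EuclideanSpace ℝ (Fin n)) : Dt M t ξ = (-Complex.I) • matDeriv (fun τ => M τ ξ) t := rfl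

/-- The index set of nonzero frequencies. -/
abbrev Freq (n : ℕ) : Type := {ξ : EuclideanSpace ℝ (Fin n) // ξ ≠ 0}

section Symbols

theorem IsDiagonaliser.msymbol (hM : IsDiagonaliser N A₁ lam M) (hN : 0 < N) :
    MSymbol 0 (fun (x : Freq n) t => M t x) :=
  fun a b => IsSymbol.tsymbol (d := 0) hN (hM.symbol a b)

theorem IsDiagonaliser.msymbol_inv (hM : IsDiagonaliser N A₁ lam M) (hN : 0 < N) :
    MSymbol 0 (fun (x : Freq n) t => (M t x)⁻¹) :=
  fun a b => IsSymbol.tsymbol (d := 0) hN (hM.symbol_inv a b)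

theorem IsDiagonaliser.msymbol_coupling (hM : IsDiagonaliser N A₁ lam M) (hN : 0 < N)
    (hA2 : AssumptionA2 N χ A A₁ lam) :
    MSymbol 1 (fun (x : Freq n) t => coupling χ N A A₁ M x t) := by
  have hL : MSymbol 1 (fun (x : Freq n) t => lower χ N A A₁ t x) := fun a b =>
    IsSymbol.tsymbol (d := 1) hN (hA2.lowerOrder a b)
  have h1 := ((hM.msymbol_inv hN).mul hL).mul (hM.msymbol hN)
  have h2 := (hM.msymbol_inv hN).mul ((hM.msymbol hN).deriv.const_smul (-Complex.I))
  exact h1.sub h2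

theorem msymbol_corrector (hA2 : AssumptionA2 N χ A A₁ lam) (hχ : IsCutoff χ)
    (hA1 : AssumptionA1 N A) (hN : 0 < N)
    {R : EuclideanSpace ℝ (Fin n) → ℝ → Matrix (Fin m) (Fin m) ℂ}
    (hR : MSymbol 1 (fun (x : Freq n) t => R x t)) :
    MSymbol 1 (fun (x : Freq n) t => corrector lam R x t) := by
  obtain ⟨c, hc, hgap⟩ := hA2.exists_gap hχ hA1 hN
  intro j k
  by_cases hjk : j = k
  · simpa [corrector, hjk] using TSymbol.zero 1
  · have h := (hR j k).mul (((hA2.tsymbol_root hN j).sub (hA2.tsymbol_root hN k)).inv hc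
      fun x t ht => hgap t ht _ (norm_unit x.2) j k hjk)
    simpa [corrector, hjk] using h

theorem msymbol_remainder (hA2 : AssumptionA2 N χ A A₁ lam) (hχ : IsCutoff χ)
    (hA1 : AssumptionA1 N A) (hN : 0 < N)
    {R : EuclideanSpace ℝ (Fin n) → ℝ → Matrix (Fin m) (Fin m) ℂ}
    (hR : MSymbol 1 (fun (x : Freq n) t => R x t)) :
    MSymbol 2 (fun (x : Freq n) t => remainder lam R x t) := by
  have hQ := msymbol_corrector hA2 hχ hA1 hN hR
  have hD : MSymbol 1 (fun (x : Freq n) t => Matrix.diagonal (R x t).diag) :=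
    MSymbol.diagonal fun j => hR j j
  exact ((hQ.mul hR).sub (hQ.deriv.const_smul Complex.I)).sub (hD.mul hQ)

end Symbols

/-- `coupling` carries the cut-off so as to be a symbol of order one for all `t ≥ 0`. Inside the
zone the cut-off is invisible. -/
theorem F0_eq (hχ : IsCutoff χ) (hN : 0 < N) {t : ℝ} {ξ : EuclideanSpace ℝ (Fin n)}
    (h : N ≤ (1 + t) * ‖ξ‖) :
    F0 A A₁ M t ξ = Matrix.diagonal (coupling χ N A A₁ M ξ t).diag := by
  rw [F0, coupling, lower_eq hχ hN h]

/-- Differentiating `M⁻¹ M = 1` trades `(M⁻¹)' M` for `-M⁻¹ M'`. The result is the coefficient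
matrix of the equation for `W = M⁻¹ U`. -/
theorem coupling_eq (hM : IsDiagonaliser N A₁ lam M) (hN : 0 < N) (hχ : IsCutoff χ) {t : ℝ}
    (ht : 0 ≤ t) {ξ : EuclideanSpace ℝ (Fin n)} (hξ : ξ ≠ 0) (h : N ≤ (1 + t) * ‖ξ‖) :
    matDeriv (fun τ => (M τ ξ)⁻¹) t * M t ξ + (M t ξ)⁻¹ * (Complex.I • (A t ξ * M t ξ))
      = Complex.I • (Matrix.diagonal (fun j => (lam j t ξ : ℂ)) + coupling χ N A A₁ M ξ t) := by
  have hI := hM.msymbol_inv hN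
  have hdet := hM.invertible t ht ξ hξ
  have h1 := hI.matDeriv_mul (hM.msymbol hN) ⟨ξ, hξ⟩ ht
  have h2 : matDeriv (fun τ => (M τ ξ)⁻¹ * M τ ξ) t = 0 := by
    rw [matDeriv_congr (Q := fun _ => 1) (fun τ hτ =>
      Matrix.nonsing_inv_mul _ (hM.invertible τ hτ ξ hξ)) ht]
    ext a b
    simp [matDeriv]
  rw [h2] at h1
  have h3 : matDeriv (fun τ => (M τ ξ)⁻¹) t * M t ξ
      = -((M t ξ)⁻¹ * matDeriv (fun τ => M τ ξ) t) := eq_neg_of_add_eq_zero_left h1.symm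
  have h4 : (M t ξ)⁻¹ * (A t ξ * M t ξ) = (M t ξ)⁻¹ * (A t ξ - A₁ t ξ) * M t ξ
      + Matrix.diagonal (fun j => (lam j t ξ : ℂ)) := by
    rw [mul_sub, sub_mul, mul_assoc _ (A₁ t ξ), hM.diagonalises t ht ξ hξ,
      Matrix.nonsing_inv_mul_cancel_left _ _ hdet, mul_assoc, sub_add_cancel]
  rw [h3, mul_smul_comm, h4, coupling, lower_eq hχ hN h, Dt_eq, mul_smul_comm, neg_smul,
    sub_neg_eq_add]
  simp only [smul_add, smul_smul, Complex.I_mul_I, neg_smul, one_smul]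
  abel

/-- Off the diagonal this says `R_jk = |ξ|⁻¹ (λ_j - λ_k)(ξ) Q_jk`, and homogeneity of the roots
cancels `|ξ|`. -/
theorem corrector_identity (hA2 : AssumptionA2 N χ A A₁ lam) {t : ℝ} (ht : 0 ≤ t)
    {ξ : EuclideanSpace ℝ (Fin n)} (hξ : ξ ≠ 0)
    (R : EuclideanSpace ℝ (Fin n) → ℝ → Matrix (Fin m) (Fin m) ℂ) :
    R ξ t + (‖ξ‖⁻¹ : ℂ) • (corrector lam R ξ t * Matrix.diagonal (fun j => (lam j t ξ : ℂ)))
      = Matrix.diagonal (R ξ t).diag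
        + (‖ξ‖⁻¹ : ℂ) • (Matrix.diagonal (fun j => (lam j t ξ : ℂ)) * corrector lam R ξ t) := by
  have hr : (‖ξ‖ : ℂ) ≠ 0 := by exact_mod_cast norm_ne_zero_iff.2 hξ
  ext j k
  simp only [Matrix.add_apply, Matrix.smul_apply, Matrix.mul_diagonal, Matrix.diagonal_mul,
    corrector, Matrix.of_apply, smul_eq_mul]
  by_cases hjk : j = k
  · subst hjk
    simp
  · have hinj := (hA2.strictMono t ht _ (unit_ne_zero hξ)).injective
    have hne : (lam j t (unit ξ) : ℂ) - lam k t (unit ξ) ≠ 0 := by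
      rw [sub_ne_zero]
      exact_mod_cast fun h => hjk (hinj h)
    rw [Matrix.diagonal_apply_ne _ hjk, if_neg hjk, hA2.lam_eq ht hξ j, hA2.lam_eq ht hξ k]
    push_cast
    field_simp
    ring

/-- Uniform bounds for the coefficients of the reduced systems. -/
structure CoeffBounds (lam : Fin m → ℝ → EuclideanSpace ℝ (Fin n) → ℝ)
    (R : EuclideanSpace ℝ (Fin n) → ℝ → Matrix (Fin m) (Fin m) ℂ) (CR CQ CB : ℝ) : Prop where
  nonneg_R : 0 ≤ CR
  nonneg_B : 0 ≤ CB
  bound_R : ∀ ξ, ξ ≠ 0 → ∀ t, 0 ≤ t → ∀ j k, ‖R ξ t j k‖ * (1 + t) ≤ CR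
  bound_Q : ∀ ξ, ξ ≠ 0 → ∀ t, 0 ≤ t → ∀ j k, ‖corrector lam R ξ t j k‖ * (1 + t) ≤ CQ
  bound_B : ∀ ξ, ξ ≠ 0 → ∀ t, 0 ≤ t → ∀ j k, ‖remainder lam R ξ t j k‖ * (1 + t) ^ 2 ≤ CB

theorem exists_coeffBounds (hA2 : AssumptionA2 N χ A A₁ lam) (hχ : IsCutoff χ)
    (hA1 : AssumptionA1 N A) (hN : 0 < N)
    {R : EuclideanSpace ℝ (Fin n) → ℝ → Matrix (Fin m) (Fin m) ℂ}
    (hR : MSymbol 1 (fun (x : Freq n) t => R x t)) : ∃ CR CQ CB, CoeffBounds lam R CR CQ CB := by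
  obtain ⟨CR, hCR, h1⟩ := hR.bound
  obtain ⟨CQ, -, h2⟩ := (msymbol_corrector hA2 hχ hA1 hN hR).bound
  obtain ⟨CB, hCB, h3⟩ := (msymbol_remainder hA2 hχ hA1 hN hR).bound
  exact ⟨CR, CQ, CB, hCR, hCB,
    fun ξ hξ t ht j k => by simpa using h1 ⟨ξ, hξ⟩ t ht j k,
    fun ξ hξ t ht j k => by simpa using h2 ⟨ξ, hξ⟩ t ht j k,
    fun ξ hξ t ht j k => h3 ⟨ξ, hξ⟩ t ht j k⟩

/-- Solutions of `D_t U = A U` in the hyperbolic zone yield reduced systems. -/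
theorem IsDiagonaliser.reducedSystem (hM : IsDiagonaliser N A₁ lam M) (hN : 0 < N)
    (hχ : IsCutoff χ) (hA1 : AssumptionA1 N A) (hA2 : AssumptionA2 N χ A A₁ lam)
    {CR CQ CB : ℝ} (hC : CoeffBounds lam (coupling χ N A A₁ M) CR CQ CB)
    {ξ : EuclideanSpace ℝ (Fin n)} (hξ : ξ ≠ 0) {a : ℝ} (ha : 0 ≤ a) (haN : N ≤ (1 + a) * ‖ξ‖)
    {U : ℝ → Fin m → ℂ} (hU : ∀ t, 0 ≤ t → ∀ i, HasDerivWithinAt (fun τ => U τ i)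
      (Complex.I * (A t ξ *ᵥ U t) i) (Ici 0) t) :
    ReducedSystem a ‖ξ‖ CR CQ CB (fun j t => lam j t ξ) (coupling χ N A A₁ M ξ)
      (corrector lam (coupling χ N A A₁ M) ξ) (remainder lam (coupling χ N A A₁ M) ξ)
      (fun t => (M t ξ)⁻¹ *ᵥ U t)
      (fun t => (M t ξ)⁻¹ *ᵥ U t + ((‖ξ‖ : ℂ)⁻¹) •
        (corrector lam (coupling χ N A A₁ M) ξ t *ᵥ ((M t ξ)⁻¹ *ᵥ U t))) := by
  have hr : 0 < ‖ξ‖ := norm_pos_iff.2 hξ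
  have hR := hM.msymbol_coupling hN hA2
  have hQ := msymbol_corrector hA2 hχ hA1 hN hR
  have hzone : ∀ t, a ≤ t → N ≤ (1 + t) * ‖ξ‖ := fun t ht => haN.trans (by gcongr)
  set Λ : ℝ → Matrix (Fin m) (Fin m) ℂ := fun t => Matrix.diagonal fun j => (lam j t ξ : ℂ)
  set R := coupling χ N A A₁ M with hRdef
  set W : ℝ → Fin m → ℂ := fun t => (M t ξ)⁻¹ *ᵥ U t with hW
  have dW : ∀ t, a ≤ t → ∀ j, HasDerivWithinAt (fun τ => W τ j)
      ((Complex.I • ((Λ t + R ξ t) *ᵥ W t)) j) (Ici a) t := fun t ht j => by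
    have ht0 := ha.trans ht
    have h1 := hasDerivWithinAt_mulVec (w' := Complex.I • (A t ξ *ᵥ U t))
      ((hM.msymbol_inv hN).hasDeriv ⟨ξ, hξ⟩ ht0) (hU t ht0) j
    refine (h1.mono (Ici_subset_Ici.2 ha)).congr_deriv (congrFun ?_ j)
    have hUW : U t = M t ξ *ᵥ W t := by
      rw [hW, Matrix.mulVec_mulVec, Matrix.mul_nonsing_inv _ (hM.invertible t ht0 ξ hξ),
        Matrix.one_mulVec]
    have h2 := coupling_eq hM hN hχ ht0 hξ (hzone t ht) (A := A)
    have h3 := congrArg (· *ᵥ W t) h2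
    simp only [Matrix.add_mulVec, Matrix.smul_mulVec, ← Matrix.mulVec_mulVec, ← hUW] at h3
    rw [Matrix.add_mulVec (Λ t)]
    exact h3
  refine ⟨ha, hr, fun t ht => hC.bound_R ξ hξ t (ha.trans ht),
    fun t ht => hC.bound_Q ξ hξ t (ha.trans ht), fun t ht => hC.bound_B ξ hξ t (ha.trans ht),
    fun t ht j => ?_, fun t => rfl, fun t ht j => ?_⟩
  · refine (dW t ht j).congr_deriv ?_
    simp [Λ, Matrix.add_mulVec, Matrix.mulVec_diagonal]
  · have ht0 := ha.trans ht
    have h1 := (hasDerivWithinAt_mulVec (fun a' b => (hQ.hasDeriv ⟨ξ, hξ⟩ ht0 a' b).mono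
      (Ici_subset_Ici.2 ha)) (dW t ht) j).const_mul ((‖ξ‖ : ℂ)⁻¹)
    refine ((dW t ht j).add h1).congr_deriv ?_
    set Q := corrector lam R ξ t with hQt
    set r : ℂ := (‖ξ‖ : ℂ)⁻¹ with hrr
    have e1 : Complex.I • ((Λ t + R ξ t) *ᵥ W t) + r • (matDeriv (corrector lam R ξ) t *ᵥ W t +
        Q *ᵥ (Complex.I • ((Λ t + R ξ t) *ᵥ W t)))
        = Complex.I • ((Λ t + Matrix.diagonal (R ξ t).diag) *ᵥ (W t + r • (Q *ᵥ W t))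
          + r • (remainder lam R ξ t *ᵥ W t)) := by
      -- Here `r = |ξ|⁻¹`. Divided by `i`, the claim is `D_t(1 + rQ) + (1 + rQ)(Λ + R) = (Λ + diag
      -- R)(1 + rQ) + rB`. The terms `R`, `diag R`, `rQΛ` and `rΛQ` match by the corrector identity,
      -- and the rest is the definition of `B`.
      have e2 : Complex.I • (Λ t + R ξ t) + r • (matDeriv (corrector lam R ξ) t +
          Q * (Complex.I • (Λ t + R ξ t)))
          = Complex.I • ((Λ t + Matrix.diagonal (R ξ t).diag) * (1 + r • Q)
            + r • remainder lam R ξ t) := by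
        have e3 : R ξ t + r • (Q * Λ t) = Matrix.diagonal (R ξ t).diag + r • (Λ t * Q) := by
          have := corrector_identity hA2 ht0 hξ R
          exact this
        have e4 : R ξ t = Matrix.diagonal (R ξ t).diag + r • (Λ t * Q) - r • (Q * Λ t) :=
          eq_sub_of_add_eq e3
        have e5 : Complex.I • (r • (Complex.I • matDeriv (corrector lam R ξ) t))
            = -(r • matDeriv (corrector lam R ξ) t) := by
          rw [smul_comm r, smul_smul, Complex.I_mul_I, neg_one_smul]
        rw [remainder, ← hQt]
        simp only [smul_sub, smul_add, mul_add, add_mul, mul_smul_comm, mul_one, e5]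
        rw [show Complex.I • R ξ t = Complex.I • (Matrix.diagonal (R ξ t).diag
          + r • (Λ t * Q) - r • (Q * Λ t)) by rw [← e4]]
        simp only [smul_sub, smul_add, smul_comm r Complex.I]
        abel
      have e6 := congrArg (· *ᵥ W t) e2
      simp only [Matrix.add_mulVec, Matrix.smul_mulVec, ← Matrix.mulVec_mulVec, Matrix.one_mulVec]
        at e6
      simp only [Matrix.add_mulVec]
      exact e6
    have e7 := congrFun e1 j
    refine Eq.trans ?_ (e7.trans ?_)
    · rfl
    · simp only [Λ, Pi.smul_apply, Pi.add_apply, Matrix.add_mulVec, Matrix.mulVec_diagonal,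
        Matrix.diag_apply, smul_eq_mul]
      ring

end Diagonalisation

/-! ### Generalised energy conservation -/

section Energy

variable {n m : ℕ} {N : ℝ} {χ : ℝ → ℝ}
  {A A₁ M : ℝ → EuclideanSpace ℝ (Fin n) → Matrix (Fin m) (Fin m) ℂ}
  {lam : Fin m → ℝ → EuclideanSpace ℝ (Fin n) → ℝ}

/-- The time at which the zone `(1 + t) r ≥ K` is entered. -/
noncomputable def zoneStart (K r : ℝ) : ℝ := max 0 (K / r - 1)

theorem zoneStart_nonneg (K r : ℝ) : 0 ≤ zoneStart K r := le_max_left _ _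

theorem zoneStart_le_iff {K r t : ℝ} (hr : 0 < r) :
    zoneStart K r ≤ t ↔ 0 ≤ t ∧ K ≤ (1 + t) * r := by
  rw [zoneStart, max_le_iff, sub_le_iff_le_add, div_le_iff₀ hr, add_comm t]

theorem zoneStart_mono {K K' r : ℝ} (hr : 0 < r) (h : K ≤ K') :
    zoneStart K r ≤ zoneStart K' r :=
  max_le_max le_rfl (sub_le_sub_right (div_le_div_of_nonneg_right h hr.le) 1)

theorem zoneStart_spec {K r : ℝ} (hr : 0 < r) : K ≤ (1 + zoneStart K r) * r :=
  ((zoneStart_le_iff hr).1 le_rfl).2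

/-- If `t` precedes the entrance to the smaller zone, then `1 + t ≥ N / r`, while that entrance is
at time `0` or has `1 + t = N' / r`. Either way `1 + t` grows by a factor of at most `N' / N`. -/
theorem abs_log_clamp_sub_le {N' r t : ℝ} (hN : 0 < N) (hNN' : N ≤ N') (hr : 0 < r)
    (ht : zoneStart N r ≤ t) :
    |Real.log (1 + max t (zoneStart N' r)) - Real.log (1 + t)| ≤ Real.log (N' / N) := by
  have hlog : 0 ≤ Real.log (N' / N) := Real.log_nonneg ((one_le_div hN).2 hNN')
  obtain ⟨ht0, htN⟩ := (zoneStart_le_iff hr).1 ht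
  rcases le_total (zoneStart N' r) t with h | h
  · rw [max_eq_left h, sub_self, abs_zero]
    exact hlog
  · rw [max_eq_right h, ← Real.log_div (by linarith) (by linarith), abs_of_nonneg]
    · refine Real.log_le_log (div_pos (by linarith) (by linarith)) ?_
      rw [div_le_div_iff₀ (by linarith) hN]
      rcases max_choice 0 (N' / r - 1) with h1 | h1
      · have h2 : zoneStart N' r = 0 := h1
        rw [h2, add_zero, one_mul]
        nlinarith
      · have h2 : zoneStart N' r = N' / r - 1 := h1
        rw [h2, add_sub_cancel, div_mul_eq_mul_div, div_le_iff₀ hr, mul_assoc]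
        exact mul_le_mul_of_nonneg_left htN (hN.le.trans hNN')
    · exact Real.log_nonneg ((one_le_div (by linarith)).2 (by linarith))

/-- The primitive of the imaginary part of a diagonal entry of the coupling. -/
noncomputable def imPrimitive (R : EuclideanSpace ℝ (Fin n) → ℝ → Matrix (Fin m) (Fin m) ℂ)
    (ξ : EuclideanSpace ℝ (Fin n)) (j : Fin m) (t : ℝ) : ℝ :=
  ∫ θ in (0 : ℝ)..t, (R ξ (max θ 0) j j).im

section imPrimitive

variable {R : EuclideanSpace ℝ (Fin n) → ℝ → Matrix (Fin m) (Fin m) ℂ}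

/-- Clamping at `0` makes the integrand continuous on the line, so its primitive has a two-sided
derivative even at `t = 0`. -/
theorem continuous_im_coupling (hR : MSymbol 1 (fun (x : Freq n) t => R x t))
    {ξ : EuclideanSpace ℝ (Fin n)} (hξ : ξ ≠ 0) (j : Fin m) :
    Continuous fun θ => (R ξ (max θ 0) j j).im := by
  have h : ContinuousOn (fun t => R ξ t j j) (Ici 0) := fun t ht =>
    (hR.hasDeriv ⟨ξ, hξ⟩ ht j j).continuousWithinAt
  exact Complex.continuous_im.comp (h.comp_continuous (by fun_prop) fun t => le_max_right t 0)

theorem hasDerivAt_imPrimitive (hR : MSymbol 1 (fun (x : Freq n) t => R x t))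
    {ξ : EuclideanSpace ℝ (Fin n)} (hξ : ξ ≠ 0) (j : Fin m) {t : ℝ}
    (ht : 0 ≤ t) : HasDerivAt (imPrimitive R ξ j) (R ξ t j j).im t := by
  have hc := continuous_im_coupling hR hξ j
  have h := intervalIntegral.integral_hasDerivAt_right (hc.intervalIntegrable 0 t)
    (hc.stronglyMeasurableAtFilter _ _) hc.continuousAt
  rwa [max_eq_left ht] at h

theorem imPrimitive_sub (hR : MSymbol 1 (fun (x : Freq n) t => R x t))
    {ξ : EuclideanSpace ℝ (Fin n)} (hξ : ξ ≠ 0) (j : Fin m) (s t : ℝ) :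
    imPrimitive R ξ j t - imPrimitive R ξ j s = ∫ θ in s..t, (R ξ (max θ 0) j j).im :=
  intervalIntegral.integral_interval_sub_left
    ((continuous_im_coupling hR hξ j).intervalIntegrable _ _)
    ((continuous_im_coupling hR hξ j).intervalIntegrable _ _)

end imPrimitive

theorem imPart_diagonal (d : Fin m → ℂ) :
    imPart (Matrix.diagonal d) = Matrix.diagonal fun j => ((d j).im : ℂ) := by
  ext i j
  by_cases hij : i = j
  · subst hij
    simp only [imPart, Matrix.smul_apply, Matrix.sub_apply, Matrix.conjTranspose_apply,
      Matrix.diagonal_apply_eq, smul_eq_mul, Complex.star_def, Complex.sub_conj]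
    push_cast
    field_simp
  · simp [imPart, Matrix.diagonal_apply_ne _ hij]

/-- The energy conservation property in terms of the primitives of `Im R_jj`. -/
theorem assumptionA3_iff (hM : IsDiagonaliser N A₁ lam M) (hN : 0 < N) (hχ : IsCutoff χ)
    (hA2 : AssumptionA2 N χ A A₁ lam) :
    AssumptionA3 N A A₁ M ↔ ∃ C : ℝ, 0 ≤ C ∧ ∀ ξ, ξ ≠ 0 → ∀ s t, zoneStart N ‖ξ‖ ≤ s →
      zoneStart N ‖ξ‖ ≤ t → ∀ j, |imPrimitive (coupling χ N A A₁ M) ξ j t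
        - imPrimitive (coupling χ N A A₁ M) ξ j s| ≤ C := by
  have hR := hM.msymbol_coupling hN hA2
  have key : ∀ ξ, ξ ≠ 0 → ∀ s t, zoneStart N ‖ξ‖ ≤ s → zoneStart N ‖ξ‖ ≤ t →
      (Matrix.of fun i j => ∫ θ in s..t, imPart (F0 A A₁ M θ ξ) i j : Matrix (Fin m) (Fin m) ℂ)
        = Matrix.diagonal fun j => ((imPrimitive (coupling χ N A A₁ M) ξ j t
            - imPrimitive (coupling χ N A A₁ M) ξ j s : ℝ) : ℂ) := by
    intro ξ hξ s t hs ht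
    have hcongr : ∀ i j, ∀ θ ∈ uIcc s t, imPart (F0 A A₁ M θ ξ) i j =
        Matrix.diagonal (fun j => ((coupling χ N A A₁ M ξ (max θ 0) j j).im : ℂ)) i j :=
      fun i j θ hθ => by
        have h1 : zoneStart N ‖ξ‖ ≤ θ := (le_min hs ht).trans hθ.1
        obtain ⟨h2, h3⟩ := (zoneStart_le_iff (norm_pos_iff.2 hξ)).1 h1
        rw [F0_eq hχ hN h3, imPart_diagonal, max_eq_left h2]
        rfl
    ext i j
    rw [Matrix.of_apply, intervalIntegral.integral_congr (hcongr i j)]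
    by_cases hij : i = j
    · subst hij
      simp only [Matrix.diagonal_apply_eq]
      rw [imPrimitive_sub hR hξ, intervalIntegral.integral_ofReal]
    · simp [Matrix.diagonal_apply_ne _ hij]
  constructor
  · rintro ⟨C, hC⟩
    refine ⟨max C 0, le_max_right _ _, fun ξ hξ s t hs ht j => ?_⟩
    have hr := norm_pos_iff.2 hξ
    have h := hC s t ξ ((zoneStart_le_iff hr).1 hs) ((zoneStart_le_iff hr).1 ht)
    rw [key ξ hξ s t hs ht, Matrix.l2_opNorm_diagonal] at h
    have h2 := (norm_le_pi_norm _ j).trans h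
    rw [Complex.norm_real] at h2
    exact h2.trans (le_max_left _ _)
  · rintro ⟨C, hC0, hC⟩
    refine ⟨C, fun s t ξ hs ht => ?_⟩
    have hξ : ξ ≠ 0 := by
      rintro rfl
      have := hs.2
      simp only [norm_zero, mul_zero] at this
      linarith
    have hr := norm_pos_iff.2 hξ
    have hs' := (zoneStart_le_iff hr).2 hs
    have ht' := (zoneStart_le_iff hr).2 ht
    rw [key ξ hξ s t hs' ht', Matrix.l2_opNorm_diagonal, pi_norm_le_iff_of_nonneg hC0]
    intro j
    rw [Complex.norm_real]
    exact hC ξ hξ s t hs' ht' j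

/-- Between the thresholds `N` and `N'` the logarithmic loss of the rough estimate is a fixed
constant, so the analysis may be confined to the smaller zone. -/
theorem ReducedSystem.normSqSum_W_clamp {r CR CQ CB : ℝ} {ℓ : Fin m → ℝ → ℝ}
    {R Q B : ℝ → Matrix (Fin m) (Fin m) ℂ} {W z : ℝ → Fin m → ℂ} {N' : ℝ}
    (h : ReducedSystem (zoneStart N r) r CR CQ CB ℓ R Q B W z) (hN : 0 < N) (hNN' : N ≤ N')
    (hCR : 0 ≤ CR) {t : ℝ} (ht : zoneStart N r ≤ t) :
    normSqSum (W t) ≤ Real.exp (2 * CR * m * Real.log (N' / N)) *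
        normSqSum (W (max t (zoneStart N' r))) ∧
      normSqSum (W (max t (zoneStart N' r))) ≤ Real.exp (2 * CR * m * Real.log (N' / N)) *
        normSqSum (W t) := by
  have h1 := abs_log_clamp_sub_le hN hNN' h.norm_pos ht
  have ht' : zoneStart N r ≤ max t (zoneStart N' r) := ht.trans (le_max_left _ _)
  have hc : 0 ≤ 2 * CR * m := by positivity
  constructor
  · refine (h.normSqSum_W_le ht' ht).trans
      (mul_le_mul_of_nonneg_right (Real.exp_le_exp.2 ?_) (normSqSum_nonneg _))
    rw [abs_sub_comm, ← mul_sub, abs_mul, abs_of_nonneg hc]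
    gcongr
  · refine (h.normSqSum_W_le ht ht').trans
      (mul_le_mul_of_nonneg_right (Real.exp_le_exp.2 ?_) (normSqSum_nonneg _))
    rw [← mul_sub, abs_mul, abs_of_nonneg hc]
    gcongr

/-- Uniform two-sided energy bounds for all solutions in the hyperbolic zone. -/
theorem exists_energy_bound (hM : IsDiagonaliser N A₁ lam M) (hN : 0 < N)
    (hχ : IsCutoff χ) (hA1 : AssumptionA1 N A) (hA2 : AssumptionA2 N χ A A₁ lam)
    (hA3 : AssumptionA3 N A A₁ M) :
    ∃ K : ℝ, 0 ≤ K ∧ ∀ ξ, ξ ≠ 0 → ∀ U : ℝ → Fin m → ℂ,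
      (∀ t, 0 ≤ t → ∀ i, HasDerivWithinAt (fun τ => U τ i)
        (Complex.I * (A t ξ *ᵥ U t) i) (Ici 0) t) →
      ∀ s t, zoneStart N ‖ξ‖ ≤ s → zoneStart N ‖ξ‖ ≤ t →
        normSqSum (U t) ≤ K * normSqSum (U s) := by
  obtain ⟨C, hC0, hC⟩ := (assumptionA3_iff hM hN hχ hA2).1 hA3
  have hR := hM.msymbol_coupling hN hA2
  obtain ⟨CR, CQ, CB, hb⟩ := exists_coeffBounds hA2 hχ hA1 hN hR
  obtain ⟨CM, hCM0, hCM⟩ := (hM.msymbol hN).bound'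
  obtain ⟨CI, hCI0, hCI⟩ := (hM.msymbol_inv hN).bound'
  set N' : ℝ := max N (2 * m * CQ) with hN'
  have hNN' : N ≤ N' := le_max_left _ _
  have hN'0 : 0 < N' := hN.trans_le hNN'
  set K₁ : ℝ := Real.exp (2 * CR * m * Real.log (N' / N)) with hK₁
  set K₂ : ℝ := Real.exp (4 * C + 6 * m * CB * Real.exp (4 * C) / N') with hK₂
  -- One factor for each link of the chain `U(t), W(t), W(t'), z(t'), z(s'), W(s'), W(s), U(s)`,
  -- where primes denote times moved into the smaller zone.
  refine ⟨(m * CM) ^ 2 * (K₁ * (4 * (K₂ * (4 * (K₁ * (m * CI) ^ 2))))), by positivity,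
    fun ξ hξ U hU s t hs ht => ?_⟩
  have hr := norm_pos_iff.2 hξ
  have hred := hM.reducedSystem hN hχ hA1 hA2 hb hξ (zoneStart_nonneg N ‖ξ‖)
    (zoneStart_spec hr) hU
  have hred' := hred.mono (zoneStart_mono hr hNN')
  have hs0 := ((zoneStart_le_iff hr).1 hs).1
  have ht0 := ((zoneStart_le_iff hr).1 ht).1
  set W : ℝ → Fin m → ℂ := fun t => (M t ξ)⁻¹ *ᵥ U t with hW
  have hUW : U t = M t ξ *ᵥ W t := by
    rw [hW, Matrix.mulVec_mulVec, Matrix.mul_nonsing_inv _ (hM.invertible t ht0 ξ hξ),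
      Matrix.one_mulVec]
  set t' := max t (zoneStart N' ‖ξ‖) with ht'
  set s' := max s (zoneStart N' ‖ξ‖) with hs'
  have e1 : normSqSum (U t) ≤ (m * CM) ^ 2 * normSqSum (W t) := by
    rw [hUW]
    exact normSqSum_mulVec_le (hCM ⟨ξ, hξ⟩ t ht0) _
  have e2 := (hred.normSqSum_W_clamp hN hNN' hb.nonneg_R ht).1
  have e3 := (hred'.normSqSum_compare hN'0 (zoneStart_spec hr) (le_max_right _ _)
    (le_max_right t _)).1
  have e4 := hred'.normSqSum_z_le hN'0 (zoneStart_spec hr) (le_max_right _ _) hb.nonneg_B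
    (G := imPrimitive (coupling χ N A A₁ M) ξ)
    (fun j t ht => (hasDerivAt_imPrimitive hR hξ j
      ((zoneStart_nonneg _ _).trans ht)).hasDerivWithinAt)
    (C := C) (fun j s t hs ht => hC ξ hξ s t ((zoneStart_mono hr hNN').trans hs)
      ((zoneStart_mono hr hNN').trans ht) j) (le_max_right s _) (le_max_right t _)
  have e5 := (hred'.normSqSum_compare hN'0 (zoneStart_spec hr) (le_max_right _ _)
    (le_max_right s _)).2
  have e6 := (hred.normSqSum_W_clamp hN hNN' hb.nonneg_R hs).2
  have e7 : normSqSum (W s) ≤ (m * CI) ^ 2 * normSqSum (U s) :=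
    normSqSum_mulVec_le (hCI ⟨ξ, hξ⟩ s hs0) _
  have hK₁0 : 0 ≤ K₁ := Real.exp_nonneg _
  have hK₂0 : 0 ≤ K₂ := Real.exp_nonneg _
  have step : ∀ {x y z c d : ℝ}, x ≤ c * y → 0 ≤ c → y ≤ d * z → x ≤ c * d * z :=
    fun h1 h2 h3 => h1.trans ((mul_le_mul_of_nonneg_left h3 h2).trans_eq (by ring))
  have f1 := step e6 hK₁0 e7
  have f2 := step e5 (by norm_num) f1
  have f3 := step e4 hK₂0 f2
  have f4 := step e3 (by norm_num) f3
  have f5 := step e2 hK₁0 f4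
  exact step e1 (by positivity) f5

/-! ### Bounds for the fundamental solution -/

theorem norm_sq_toEuclideanLin (E : Matrix (Fin m) (Fin m) ℂ) (V : EuclideanSpace ℂ (Fin m)) :
    ‖Matrix.toEuclideanLin E V‖ ^ 2 = normSqSum (E *ᵥ V.ofLp) := by
  rw [EuclideanSpace.norm_sq_eq]
  rfl

theorem IsFundamentalSolution.hasDeriv_mulVec
    {E : ℝ → ℝ → EuclideanSpace ℝ (Fin n) → Matrix (Fin m) (Fin m) ℂ}
    (hE : IsFundamentalSolution A E) {s : ℝ} (hs : 0 ≤ s) {ξ : EuclideanSpace ℝ (Fin n)}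
    (hξ : ξ ≠ 0) (v : Fin m → ℂ) {t : ℝ} (ht : 0 ≤ t) (i : Fin m) :
    HasDerivWithinAt (fun τ => (E τ s ξ *ᵥ v) i)
      (Complex.I * (A t ξ *ᵥ (E t s ξ *ᵥ v)) i) (Ici 0) t := by
  have h := hasDerivWithinAt_mulVec (P' := Complex.I • (A t ξ * E t s ξ))
    (w := fun _ => v) (w' := 0) (fun a b => hE.ode s hs ξ hξ t ht a b)
    (fun a => hasDerivWithinAt_const t _ (v a)) i
  refine h.congr_deriv ?_
  simp [Matrix.smul_mulVec]

theorem ne_zero_of_mem_hypZone (hN : 0 < N) {t : ℝ} {ξ : EuclideanSpace ℝ (Fin n)}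
    (h : (t, ξ) ∈ hypZone n N) : ξ ≠ 0 := by
  rintro rfl
  have := h.2
  simp only [norm_zero, mul_zero] at this
  linarith

theorem energy_estimate_of_assumptionA3 (hM : IsDiagonaliser N A₁ lam M) (hN : 0 < N)
    (hχ : IsCutoff χ) (hA1 : AssumptionA1 N A) (hA2 : AssumptionA2 N χ A A₁ lam)
    {E : ℝ → ℝ → EuclideanSpace ℝ (Fin n) → Matrix (Fin m) (Fin m) ℂ}
    (hE : IsFundamentalSolution A E) (hA3 : AssumptionA3 N A A₁ M) :
    ∃ C : ℝ, 0 < C ∧ ∀ (t s : ℝ) (ξ : EuclideanSpace ℝ (Fin n)),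
      (t, ξ) ∈ hypZone n N → (s, ξ) ∈ hypZone n N → ∀ V : EuclideanSpace ℂ (Fin m),
        C⁻¹ * ‖V‖ ≤ ‖Matrix.toEuclideanLin (E t s ξ) V‖ ∧
        ‖Matrix.toEuclideanLin (E t s ξ) V‖ ≤ C * ‖V‖ := by
  obtain ⟨K, hK0, hK⟩ := exists_energy_bound hM hN hχ hA1 hA2 hA3
  refine ⟨K + 1, by linarith, fun t s ξ ht hs V => ?_⟩
  have hξ := ne_zero_of_mem_hypZone hN ht
  have hr := norm_pos_iff.2 hξ
  have hV : normSqSum (E s s ξ *ᵥ V.ofLp) = ‖V‖ ^ 2 := by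
    rw [hE.initial s hs.1 ξ hξ, Matrix.one_mulVec, EuclideanSpace.norm_sq_eq]
    rfl
  have hU := hK ξ hξ (fun τ => E τ s ξ *ᵥ V.ofLp)
    (fun t ht i => hE.hasDeriv_mulVec hs.1 hξ V.ofLp ht i)
  have h1 := hU s t ((zoneStart_le_iff hr).2 hs) ((zoneStart_le_iff hr).2 ht)
  -- The lower bound is the energy estimate for the same solution with the two times exchanged.
  have h2 := hU t s ((zoneStart_le_iff hr).2 ht) ((zoneStart_le_iff hr).2 hs)
  rw [hV, ← norm_sq_toEuclideanLin] at h1 h2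
  have key : ∀ x y : ℝ, 0 ≤ y → x ^ 2 ≤ K * y ^ 2 → x ≤ (K + 1) * y := fun x y hy h =>
    le_of_sq_le_sq (h.trans (by nlinarith [sq_nonneg y])) (by positivity)
  refine ⟨?_, key _ _ (norm_nonneg _) h1⟩
  rw [inv_mul_le_iff₀ (by linarith)]
  exact key _ _ (norm_nonneg _) h2

/-- The upper bound alone suffices, since it holds for both orders of the times. In the smaller zone
the drop of each primitive is bounded from either time to the other; the strip before it contributes
a logarithm. -/
theorem assumptionA3_of_energy_estimate (hM : IsDiagonaliser N A₁ lam M) (hN : 0 < N)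
    (hχ : IsCutoff χ) (hA1 : AssumptionA1 N A) (hA2 : AssumptionA2 N χ A A₁ lam)
    {E : ℝ → ℝ → EuclideanSpace ℝ (Fin n) → Matrix (Fin m) (Fin m) ℂ}
    (hE : IsFundamentalSolution A E) {C : ℝ}
    (hC : ∀ (t s : ℝ) (ξ : EuclideanSpace ℝ (Fin n)), (t, ξ) ∈ hypZone n N →
      (s, ξ) ∈ hypZone n N → ∀ V : EuclideanSpace ℂ (Fin m),
        ‖Matrix.toEuclideanLin (E t s ξ) V‖ ≤ C * ‖V‖) : AssumptionA3 N A A₁ M := by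
  have hR := hM.msymbol_coupling hN hA2
  obtain ⟨CR, CQ, CB, hb⟩ := exists_coeffBounds hA2 hχ hA1 hN hR
  obtain ⟨CM, hCM0, hCM⟩ := (hM.msymbol hN).bound'
  obtain ⟨CI, hCI0, hCI⟩ := (hM.msymbol_inv hN).bound'
  set D : ℝ := (m * CI) ^ 2 * (C ^ 2 * (m * CM) ^ 2) + 1 with hD
  have hD0 : 0 < D := by positivity
  -- The second entry makes `z` and `W` comparable, the third keeps the remainder's effect below one
  -- half.
  set N' : ℝ := max N (max (2 * m * CQ) (2 * ((4 + m) * D * CB))) with hN'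
  have hNN' : N ≤ N' := le_max_left _ _
  have hN'0 : 0 < N' := hN.trans_le hNN'
  set P := imPrimitive (coupling χ N A A₁ M) with hP
  have hfar : ∀ ξ, ξ ≠ 0 → ∀ s t, zoneStart N' ‖ξ‖ ≤ s → zoneStart N' ‖ξ‖ ≤ t → ∀ j,
      P ξ j s - P ξ j t ≤ |Real.log (8 * D) / 2| := by
    intro ξ hξ s t hs ht j
    have hr := norm_pos_iff.2 hξ
    have hzone : ∀ u, zoneStart N' ‖ξ‖ ≤ u → (u, ξ) ∈ hypZone n N := fun u hu =>
      (zoneStart_le_iff hr).1 ((zoneStart_mono hr hNN').trans hu)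
    -- Initial data whose diagonalised form `M⁻¹ v` is the `j`-th unit vector.
    set v : ℝ → Fin m → ℂ := fun s => M s ξ *ᵥ Pi.single j 1 with hv
    have hsys := fun s (hs : zoneStart N' ‖ξ‖ ≤ s) =>
      (hM.reducedSystem hN hχ hA1 hA2 hb hξ (zoneStart_nonneg N' ‖ξ‖)
        (hNN'.trans (zoneStart_spec hr)) fun t ht i =>
          hE.hasDeriv_mulVec (hzone s hs).1 hξ (v s) ht i)
    refine le_trans ?_ (le_abs_self _)
    refine sub_le_of_bounded_solutions hN'0 hr (zoneStart_nonneg _ _) (zoneStart_spec hr)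
      ((le_max_left _ _).trans (le_max_right _ _)) hb.nonneg_B hD0
      ((le_max_right _ _).trans (le_max_right _ _)) (j := j) (fun t => by simp [corrector])
      hsys (fun s hs => ?_) (fun s t hs ht => ?_)
      (fun t ht => (hasDerivAt_imPrimitive hR hξ j
        ((zoneStart_nonneg _ _).trans ht)).hasDerivWithinAt) hs ht
    · have h0 := (hzone s hs).1
      simp only [hv]
      rw [hE.initial s h0 ξ hξ, Matrix.one_mulVec, Matrix.mulVec_mulVec,
        Matrix.nonsing_inv_mul _ (hM.invertible s h0 ξ hξ), Matrix.one_mulVec]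
    · have h1 : normSqSum ((M t ξ)⁻¹ *ᵥ (E t s ξ *ᵥ v s))
          ≤ (m * CI) ^ 2 * normSqSum (E t s ξ *ᵥ v s) :=
        normSqSum_mulVec_le (hCI ⟨ξ, hξ⟩ t (hzone t ht).1) _
      have h2 : normSqSum (E t s ξ *ᵥ v s) ≤ C ^ 2 * normSqSum (v s) := by
        have h3 := hC t s ξ (hzone t ht) (hzone s hs) (WithLp.toLp 2 (v s))
        have h4 := pow_le_pow_left₀ (norm_nonneg _) h3 2
        rw [norm_sq_toEuclideanLin, mul_pow, EuclideanSpace.norm_sq_eq] at h4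
        exact h4
      have h3 : normSqSum (v s) ≤ (m * CM) ^ 2 := by
        refine (normSqSum_mulVec_le (hCM ⟨ξ, hξ⟩ s (hzone s hs).1) _).trans_eq ?_
        have : normSqSum (Pi.single j 1 : Fin m → ℂ) = 1 := by
          rw [normSqSum, Finset.sum_eq_single j (fun k _ hk => by simp [hk]) (by simp)]
          simp
        rw [this, mul_one]
      calc _ ≤ (m * CI) ^ 2 * (C ^ 2 * (m * CM) ^ 2) := by
            refine h1.trans (mul_le_mul_of_nonneg_left (h2.trans ?_) (by positivity))
            exact mul_le_mul_of_nonneg_left h3 (by positivity)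
        _ ≤ D := by linarith
  have hnear : ∀ ξ, ξ ≠ 0 → ∀ t, zoneStart N ‖ξ‖ ≤ t → ∀ j,
      |P ξ j (max t (zoneStart N' ‖ξ‖)) - P ξ j t| ≤ CR * Real.log (N' / N) := by
    intro ξ hξ t ht j
    have hr := norm_pos_iff.2 hξ
    have ht0 : 0 ≤ t := (zoneStart_nonneg _ _).trans ht
    refine (abs_sub_le_of_abs_deriv_le (convex_Ici 0) (φ := fun t => CR * Real.log (1 + t))
      (fun t ht => (hasDerivAt_imPrimitive hR hξ j ht).hasDerivWithinAt)
      (fun t ht => (ReducedSystem.hasDerivAt_log ht CR).hasDerivWithinAt) (fun t ht => ?_)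
      (mem_Ici.2 ht0) (mem_Ici.2 (ht0.trans (le_max_left _ _)))).trans ?_
    · have ht1 : 0 < 1 + t := by linarith [mem_Ici.1 ht]
      exact (Complex.abs_im_le_norm _).trans ((le_div_iff₀ ht1).2 (hb.bound_R ξ hξ t ht j j))
    · rw [← mul_sub, abs_mul, abs_of_nonneg hb.nonneg_R]
      exact mul_le_mul_of_nonneg_left (abs_log_clamp_sub_le hN hNN' hr ht) hb.nonneg_R
  have hlog : 0 ≤ Real.log (N' / N) := Real.log_nonneg ((one_le_div hN).2 hNN')
  have hCR := mul_nonneg hb.nonneg_R hlog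
  refine (assumptionA3_iff hM hN hχ hA2).2
    ⟨2 * (CR * Real.log (N' / N)) + |Real.log (8 * D) / 2|, by positivity,
      fun ξ hξ s t hs ht j => ?_⟩
  have n1 := abs_le.1 (hnear ξ hξ s hs j)
  have n2 := abs_le.1 (hnear ξ hξ t ht j)
  have f1 := hfar ξ hξ _ _ (le_max_right s (zoneStart N' ‖ξ‖)) (le_max_right t _) j
  have f2 := hfar ξ hξ _ _ (le_max_right t (zoneStart N' ‖ξ‖)) (le_max_right s _) j
  exact abs_le.2 ⟨by linarith, by linarith⟩

end Energy

end HyperbolicSystem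

theorem mainTheorem6 (n m : ℕ) (N : ℝ) (hN : 0 < N)
    (χ : ℝ → ℝ) (hχ : HyperbolicSystem.IsCutoff χ)
    (A A₁ : ℝ → EuclideanSpace ℝ (Fin n) → Matrix (Fin m) (Fin m) ℂ)
    (lam : Fin m → ℝ → EuclideanSpace ℝ (Fin n) → ℝ)
    (hA1 : HyperbolicSystem.AssumptionA1 N A)
    (hA2 : HyperbolicSystem.AssumptionA2 N χ A A₁ lam)
    (E : ℝ → ℝ → EuclideanSpace ℝ (Fin n) → Matrix (Fin m) (Fin m) ℂ)
    (hE : HyperbolicSystem.IsFundamentalSolution A E) :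
    (∃ M, HyperbolicSystem.IsDiagonaliser N A₁ lam M) ∧
    ∀ M, HyperbolicSystem.IsDiagonaliser N A₁ lam M →
      (HyperbolicSystem.AssumptionA3 N A A₁ M ↔
        ∃ C : ℝ, 0 < C ∧ ∀ (t s : ℝ) (ξ : EuclideanSpace ℝ (Fin n)),
          (t, ξ) ∈ HyperbolicSystem.hypZone n N → (s, ξ) ∈ HyperbolicSystem.hypZone n N →
          ∀ V : EuclideanSpace ℂ (Fin m),
            C⁻¹ * ‖V‖ ≤ ‖Matrix.toEuclideanLin (E t s ξ) V‖ ∧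
            ‖Matrix.toEuclideanLin (E t s ξ) V‖ ≤ C * ‖V‖) := by
  refine ⟨hA2.exists_isDiagonaliser hχ hA1 hN, fun M hM => ⟨fun hA3 => ?_, ?_⟩⟩
  · exact HyperbolicSystem.energy_estimate_of_assumptionA3 hM hN hχ hA1 hA2 hE hA3
  · rintro ⟨C, -, hC⟩
    exact HyperbolicSystem.assumptionA3_of_energy_estimate hM hN hχ hA1 hA2 hE
      fun t s ξ ht hs V => (hC t s ξ ht hs V).2
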